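/- Let $N\ge 1$, $s\in(0,1)$, $p\in(1,\infty)$, $\lambda\ge 0$, and let $\Omega\subset\mathbb{R}^N$ be a bounded domain (nonempty, open, connected) with Lipschitz boundary. Put $\mathcal{Q}=\mathbb{R}^{2N}\setminus\big((\mathbb{R}^N\setminus\Omega)\times(\mathbb{R}^N\setminus\Omega)\big)$ and let $X$ be the normed space of measurable functions $u:\mathbb{R}^N\to\mathbb{R}$ (modulo equality almost everywhere) with $$\|u\|=\left(\iint_{\mathcal{Q}}\frac{|u(x)-u(y)|^p}{|x-y|^{N+ps}}\,dx\,dy+\int_\Omega|u|^p\,dx\right)^{1/p}<\infty .$$ Let $g:\Omega\times\mathbb{R}\to\mathbb{R}$ be a Carathéodory function ($g(\cdot,t)$ is measurable for every $t$, and $g(x,\cdot)$ is continuous for a.e. $x\in\Omega$), and let $G(x,t)=\int_0^t g(x,\tau)\,d\tau$. Assume: - $(g_1)$ there are constants $a_1,a_2>0$ and $q>p$, with $q<\frac{pN}{N-ps}$ if $N>ps$, such that $|g(x,t)|\le a_1+a_2|t|^{q-1}$ for a.e. $x\in\Omega$ and every $t\in\mathbb{R}$; - $(g_2)$ $g(x,t)=o(|t|^{p-1})$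 as $t\to0$, uniformly for a.e. $x\in\Omega$; - $(g_3)$ there are $\mu>p$ and $R\ge0$ such that $0<\mu G(x,t)\le g(x,t)t$ for a.e. $x\in\Omega$ and every $t$ with $|t|>R$; and there are $\tilde\mu>p$, $a_3>0$ and $a_4\in L^1(\Omega)$ such that $G(x,t)\ge a_3|t|^{\tilde\mu}-a_4(x)$ for a.e. $x\in\Omega$ and every $t\in\mathbb{R}$; - $(g_4)$ if $R>0$, then $G(x,t)\ge0$ for a.e. $x\in\Omega$ and every $t\in\mathbb{R}$. Then $G(\cdot,u)\in L^1(\Omega)$ for every $u\in X$, so that the functional $I:X\to\mathbb{R}$, $$I(u)=\frac1{2p}\iint_{\mathcal{Q}}\frac{|u(x)-u(y)|^p}{|x-y|^{N+ps}}\,dx\,dy-\frac{\lambda}{p}\int_\Omega|u|^p\,dx-\int_\Omega G(x,u)\,dx ,$$ is well defined; $I$ is of class $C^1$; and $I$ satisfies the Palais–Smale condition at every level: for every $c\in\mathbb{R}$, every sequence $(u_n)$ in $X$ such that $I(u_n)\to c$ and $I'(u_n)\to0$ in the dual space $X'$ has a subsequence that converges strongly in $X$. -/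

import Mathlib

open MeasureTheory Filter Topology Set

open scoped ENNReal NNReal

/-- A bounded domain (nonempty, connected, open set) of `ℝ^N` with Lipschitz boundary: near every
boundary point the domain is, in suitable orthonormal coordinates with last axis `e`, the strict
epigraph of a Lipschitz function `γ` of the component of `x` orthogonal to `e`. -/
structure BoundedLipschitzDomain (N : ℕ) where
  carrier : Set (EuclideanSpace ℝ (Fin N))
  isOpen : IsOpen carrier
  isConnected : IsConnected carrier
  isBounded : Bornology.IsBounded carrier
  lipschitz_boundary : ∀ x₀ ∈ frontier carrier,
    ∃ (r : ℝ) (e : EuclideanSpace ℝ (Fin N)) (K : ℝ≥0) (γ : EuclideanSpace ℝ (Fin N) → ℝ),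
      0 < r ∧ ‖e‖ = 1 ∧ LipschitzWith K γ ∧
      ∀ x ∈ Metric.ball x₀ r, x ∈ carrier ↔ γ (x - inner ℝ e x • e) < inner ℝ e x

namespace FracNeumann

variable {N : ℕ}

/-- `𝒬 = ℝ^{2N} \ (Ωᶜ × Ωᶜ)`. -/
def crossSet (Ω : BoundedLipschitzDomain N) :
    Set (EuclideanSpace ℝ (Fin N) × EuclideanSpace ℝ (Fin N)) :=
  (Ω.carrierᶜ ×ˢ Ω.carrierᶜ)ᶜ

/-- The integrand `|u(x) - u(y)|^p / |x - y|^{N + ps}`. -/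
noncomputable def gagliardoIntegrand (s p : ℝ) (u : EuclideanSpace ℝ (Fin N) → ℝ)
    (z : EuclideanSpace ℝ (Fin N) × EuclideanSpace ℝ (Fin N)) : ℝ :=
  |u z.1 - u z.2| ^ p / ‖z.1 - z.2‖ ^ ((N : ℝ) + p * s)

/-- `[u]^p = ∬_𝒬 |u(x) - u(y)|^p / |x - y|^{N + ps} dx dy`. -/
noncomputable def gagliardoEnergy (Ω : BoundedLipschitzDomain N) (s p : ℝ)
    (u : EuclideanSpace ℝ (Fin N) → ℝ) : ℝ :=
  ∫ z in crossSet Ω, gagliardoIntegrand s p u z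

/-- `∫_Ω |u|^p dx`. -/
noncomputable def powIntegral (Ω : BoundedLipschitzDomain N) (p : ℝ)
    (u : EuclideanSpace ℝ (Fin N) → ℝ) : ℝ :=
  ∫ x in Ω.carrier, |u x| ^ p

/-- Both integrals in the norm of `u` are finite. -/
def FiniteEnergy (Ω : BoundedLipschitzDomain N) (s p : ℝ)
    (u : EuclideanSpace ℝ (Fin N) → ℝ) : Prop :=
  IntegrableOn (gagliardoIntegrand s p u) (crossSet Ω) ∧
    IntegrableOn (fun x => |u x| ^ p) Ω.carrier

/-- The difference quotient whose `p`-th power is the integrand. -/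
noncomputable def diffQuot (s p : ℝ) (u : EuclideanSpace ℝ (Fin N) → ℝ)
    (z : EuclideanSpace ℝ (Fin N) × EuclideanSpace ℝ (Fin N)) : ℝ :=
  (u z.1 - u z.2) / ‖z.1 - z.2‖ ^ (((N : ℝ) + p * s) / p)

theorem gagliardoIntegrand_nonneg (s p : ℝ) (u : EuclideanSpace ℝ (Fin N) → ℝ)
    (z : EuclideanSpace ℝ (Fin N) × EuclideanSpace ℝ (Fin N)) :
    0 ≤ gagliardoIntegrand s p u z :=
  div_nonneg (Real.rpow_nonneg (abs_nonneg _) _) (Real.rpow_nonneg (norm_nonneg _) _)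

theorem norm_diffQuot_rpow (s : ℝ) {p : ℝ} (hp : 1 < p) (u : EuclideanSpace ℝ (Fin N) → ℝ)
    (z : EuclideanSpace ℝ (Fin N) × EuclideanSpace ℝ (Fin N)) :
    ‖diffQuot s p u z‖ ^ p = gagliardoIntegrand s p u z := by
  have h0 : 0 ≤ ‖z.1 - z.2‖ ^ (((N : ℝ) + p * s) / p) := Real.rpow_nonneg (norm_nonneg _) _
  rw [diffQuot, gagliardoIntegrand, Real.norm_eq_abs, abs_div, abs_of_nonneg h0,
    Real.div_rpow (abs_nonneg _) h0, ← Real.rpow_mul (norm_nonneg _),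
    div_mul_cancel₀ _ (by linarith : p ≠ 0)]

theorem aestronglyMeasurable_diffQuot (s p : ℝ) (u : EuclideanSpace ℝ (Fin N) →ₘ[volume] ℝ) :
    AEStronglyMeasurable (diffQuot s p u) := by
  have h1 : AEStronglyMeasurable
      (fun z : EuclideanSpace ℝ (Fin N) × EuclideanSpace ℝ (Fin N) => u z.1) :=
    u.aestronglyMeasurable.comp_quasiMeasurePreserving Measure.quasiMeasurePreserving_fst
  have h2 : AEStronglyMeasurable
      (fun z : EuclideanSpace ℝ (Fin N) × EuclideanSpace ℝ (Fin N) => u z.2) :=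
    u.aestronglyMeasurable.comp_quasiMeasurePreserving Measure.quasiMeasurePreserving_snd
  have h3 : Measurable (fun z : EuclideanSpace ℝ (Fin N) × EuclideanSpace ℝ (Fin N) =>
      ‖z.1 - z.2‖ ^ (((N : ℝ) + p * s) / p)) := by fun_prop
  exact ((h1.sub h2).aemeasurable.div h3.aemeasurable).aestronglyMeasurable

theorem diffQuot_congr (s p : ℝ) {u v : EuclideanSpace ℝ (Fin N) → ℝ} (h : u =ᵐ[volume] v) :
    diffQuot s p u =ᵐ[volume] diffQuot s p v := by
  have h1 := Measure.quasiMeasurePreserving_fst (μ := (volume : Measure (EuclideanSpace ℝ (Fin N))))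
    (ν := (volume : Measure (EuclideanSpace ℝ (Fin N)))) |>.ae h
  have h2 := Measure.quasiMeasurePreserving_snd (μ := (volume : Measure (EuclideanSpace ℝ (Fin N))))
    (ν := (volume : Measure (EuclideanSpace ℝ (Fin N)))) |>.ae h
  filter_upwards [h1, h2] with z hz1 hz2
  simp only [diffQuot, hz1, hz2]

theorem diffQuot_add (s p : ℝ) (u v : EuclideanSpace ℝ (Fin N) →ₘ[volume] ℝ) :
    diffQuot s p (u + v : EuclideanSpace ℝ (Fin N) →ₘ[volume] ℝ) =ᵐ[volume]
      diffQuot s p u + diffQuot s p v := by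
  refine (diffQuot_congr s p (AEEqFun.coeFn_add u v)).trans (Eventually.of_forall fun z => ?_)
  simp only [diffQuot, Pi.add_apply]
  ring

theorem diffQuot_smul (s p c : ℝ) (u : EuclideanSpace ℝ (Fin N) →ₘ[volume] ℝ) :
    diffQuot s p (c • u : EuclideanSpace ℝ (Fin N) →ₘ[volume] ℝ) =ᵐ[volume]
      c • diffQuot s p u := by
  refine (diffQuot_congr s p (AEEqFun.coeFn_smul c u)).trans (Eventually.of_forall fun z => ?_)
  simp only [diffQuot, Pi.smul_apply, smul_eq_mul]
  ring

theorem finiteEnergy_iff (Ω : BoundedLipschitzDomain N) (s : ℝ) {p : ℝ} (hp : 1 < p)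
    (u : EuclideanSpace ℝ (Fin N) →ₘ[volume] ℝ) :
    FiniteEnergy Ω s p u ↔
      MemLp (diffQuot s p u) (ENNReal.ofReal p) (volume.restrict (crossSet Ω)) ∧
        MemLp u (ENNReal.ofReal p) (volume.restrict Ω.carrier) := by
  have hp0 : ENNReal.ofReal p ≠ 0 := by simp; linarith
  have hpr : (ENNReal.ofReal p).toReal = p := ENNReal.toReal_ofReal (by linarith)
  rw [← integrable_norm_rpow_iff (aestronglyMeasurable_diffQuot s p u).restrict hp0
      ENNReal.ofReal_ne_top,
    ← integrable_norm_rpow_iff u.aestronglyMeasurable.restrict hp0 ENNReal.ofReal_ne_top, hpr]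
  simp only [norm_diffQuot_rpow s hp]
  rfl

/-- The functions of finite energy, modulo equality almost everywhere in `ℝ^N`. -/
def finiteEnergySubmodule (Ω : BoundedLipschitzDomain N) (s p : ℝ) [hp : Fact (1 < p)] :
    Submodule ℝ (EuclideanSpace ℝ (Fin N) →ₘ[volume] ℝ) where
  carrier := {u | FiniteEnergy Ω s p u}
  add_mem' {u v} hu hv := by
    have hu := (finiteEnergy_iff Ω s hp.out u).1 hu
    have hv := (finiteEnergy_iff Ω s hp.out v).1 hv
    exact (finiteEnergy_iff Ω s hp.out (u + v)).2
      ⟨(memLp_congr_ae (ae_restrict_of_ae (diffQuot_add s p u v))).2 (hu.1.add hv.1),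
        (memLp_congr_ae (ae_restrict_of_ae (AEEqFun.coeFn_add u v))).2 (hu.2.add hv.2)⟩
  zero_mem' := by
    refine (finiteEnergy_iff Ω s hp.out 0).2 ⟨?_, ?_⟩
    · refine (memLp_congr_ae (ae_restrict_of_ae ?_)).2 (MemLp.zero (ε := ℝ))
      refine (diffQuot_congr s p AEEqFun.coeFn_zero).trans (Eventually.of_forall fun z => ?_)
      simp [diffQuot]
    · exact (memLp_congr_ae (ae_restrict_of_ae AEEqFun.coeFn_zero)).2 (MemLp.zero (ε := ℝ))
  smul_mem' c u hu := by
    have hu := (finiteEnergy_iff Ω s hp.out u).1 hu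
    exact (finiteEnergy_iff Ω s hp.out (c • u)).2
      ⟨(memLp_congr_ae (ae_restrict_of_ae (diffQuot_smul s p c u))).2 (hu.1.const_smul c),
        (memLp_congr_ae (ae_restrict_of_ae (AEEqFun.coeFn_smul c u))).2 (hu.2.const_smul c)⟩

/-- The space `X` of measurable functions `u : ℝ^N → ℝ` (modulo a.e. equality) with `‖u‖ < ∞`. -/
def XSpace (Ω : BoundedLipschitzDomain N) (s p : ℝ) [Fact (1 < p)] : Type :=
  finiteEnergySubmodule Ω s p

section

variable (Ω : BoundedLipschitzDomain N) (s p : ℝ) [hp : Fact (1 < p)]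

noncomputable instance : AddCommGroup (XSpace Ω s p) :=
  inferInstanceAs (AddCommGroup (finiteEnergySubmodule Ω s p))

noncomputable instance : Module ℝ (XSpace Ω s p) :=
  inferInstanceAs (Module ℝ (finiteEnergySubmodule Ω s p))

noncomputable instance : CoeFun (XSpace Ω s p) fun _ => EuclideanSpace ℝ (Fin N) → ℝ :=
  ⟨fun u => (u.1 : EuclideanSpace ℝ (Fin N) → ℝ)⟩

/-- `‖u‖ = ([u]^p + ‖u‖_{L^p(Ω)}^p)^{1/p}`. -/
noncomputable instance : Norm (XSpace Ω s p) :=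
  ⟨fun u => (gagliardoEnergy Ω s p u + powIntegral Ω p u) ^ (1 / p)⟩

variable {Ω s p}

theorem XSpace.norm_def (u : XSpace Ω s p) :
    ‖u‖ = (gagliardoEnergy Ω s p u + powIntegral Ω p u) ^ (1 / p) := rfl

theorem XSpace.memLp (u : XSpace Ω s p) :
    MemLp (diffQuot s p u) (ENNReal.ofReal p) (volume.restrict (crossSet Ω)) ∧
      MemLp u (ENNReal.ofReal p) (volume.restrict Ω.carrier) :=
  (finiteEnergy_iff Ω s hp.out u.1).1 u.2

theorem rpow_eLpNorm {α : Type*} [MeasurableSpace α] {μ : Measure α} {f : α → ℝ}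
    (hf : MemLp f (ENNReal.ofReal p) μ) :
    (eLpNorm f (ENNReal.ofReal p) μ).toReal ^ p = ∫ x, ‖f x‖ ^ p ∂μ := by
  have h1 : 1 < p := hp.out
  have hp0 : ENNReal.ofReal p ≠ 0 := by simp; linarith
  have hpr : (ENNReal.ofReal p).toReal = p := ENNReal.toReal_ofReal (by linarith)
  have h0 : 0 ≤ ∫ x, ‖f x‖ ^ p ∂μ := integral_nonneg fun x => Real.rpow_nonneg (norm_nonneg _) _
  rw [hf.eLpNorm_eq_integral_rpow_norm hp0 ENNReal.ofReal_ne_top, hpr,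
    ENNReal.toReal_ofReal (Real.rpow_nonneg h0 _), ← Real.rpow_mul h0,
    inv_mul_cancel₀ (by linarith), Real.rpow_one]

theorem XSpace.norm_eq (u : XSpace Ω s p) :
    ‖u‖ = ((eLpNorm (diffQuot s p u) (ENNReal.ofReal p)
          (volume.restrict (crossSet Ω))).toReal ^ p +
        (eLpNorm u (ENNReal.ofReal p) (volume.restrict Ω.carrier)).toReal ^ p) ^ (1 / p) := by
  rw [rpow_eLpNorm u.memLp.1, rpow_eLpNorm u.memLp.2]
  simp only [norm_diffQuot_rpow s hp.out]
  rfl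

theorem XSpace.norm_triangle (u v : XSpace Ω s p) : ‖u + v‖ ≤ ‖u‖ + ‖v‖ := by
  have h1 : 1 < p := hp.out
  have h1' : (1 : ℝ≥0∞) ≤ ENNReal.ofReal p := by simpa using h1.le
  have key : ∀ {α : Type} [MeasurableSpace α] {μ : Measure α} {f g h : α → ℝ},
      MemLp f (ENNReal.ofReal p) μ → MemLp g (ENNReal.ofReal p) μ → h =ᵐ[μ] f + g →
      (eLpNorm h (ENNReal.ofReal p) μ).toReal ≤
        (eLpNorm f (ENNReal.ofReal p) μ).toReal + (eLpNorm g (ENNReal.ofReal p) μ).toReal := by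
    intro α _ μ f g h hf hg hh
    rw [eLpNorm_congr_ae hh, ← ENNReal.toReal_add hf.eLpNorm_ne_top hg.eLpNorm_ne_top]
    exact ENNReal.toReal_mono (ENNReal.add_ne_top.2 ⟨hf.eLpNorm_ne_top, hg.eLpNorm_ne_top⟩)
      (eLpNorm_add_le hf.1 hg.1 h1')
  have hA := key u.memLp.1 v.memLp.1 (ae_restrict_of_ae (diffQuot_add s p u.1 v.1))
  have hB := key u.memLp.2 v.memLp.2 (ae_restrict_of_ae (AEEqFun.coeFn_add u.1 v.1))
  have := Real.Lp_add_le_of_nonneg (s := Finset.univ) (p := p)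
    (f := ![(eLpNorm (diffQuot s p u) (ENNReal.ofReal p) (volume.restrict (crossSet Ω))).toReal,
      (eLpNorm u (ENNReal.ofReal p) (volume.restrict Ω.carrier)).toReal])
    (g := ![(eLpNorm (diffQuot s p v) (ENNReal.ofReal p) (volume.restrict (crossSet Ω))).toReal,
      (eLpNorm v (ENNReal.ofReal p) (volume.restrict Ω.carrier)).toReal]) h1.le
    (by intro i _; fin_cases i <;> simp) (by intro i _; fin_cases i <;> simp)
  simp only [Fin.sum_univ_two, Matrix.cons_val_zero, Matrix.cons_val_one] at this
  rw [XSpace.norm_eq, XSpace.norm_eq, XSpace.norm_eq]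
  refine le_trans ?_ this
  refine Real.rpow_le_rpow (by positivity) (add_le_add ?_ ?_) (by positivity)
  · exact Real.rpow_le_rpow ENNReal.toReal_nonneg hA (by linarith)
  · exact Real.rpow_le_rpow ENNReal.toReal_nonneg hB (by linarith)

theorem XSpace.norm_smul' (c : ℝ) (u : XSpace Ω s p) : ‖c • u‖ = ‖c‖ * ‖u‖ := by
  have h1 : 1 < p := hp.out
  have hA : eLpNorm (diffQuot s p (c • u)) (ENNReal.ofReal p) (volume.restrict (crossSet Ω)) =
      ‖c‖ₑ * eLpNorm (diffQuot s p u) (ENNReal.ofReal p) (volume.restrict (crossSet Ω)) := by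
    rw [← eLpNorm_const_smul]
    exact eLpNorm_congr_ae (ae_restrict_of_ae (diffQuot_smul s p c u.1))
  have hB : eLpNorm (c • u) (ENNReal.ofReal p) (volume.restrict Ω.carrier) =
      ‖c‖ₑ * eLpNorm u (ENNReal.ofReal p) (volume.restrict Ω.carrier) := by
    rw [← eLpNorm_const_smul]
    exact eLpNorm_congr_ae (ae_restrict_of_ae (AEEqFun.coeFn_smul c u.1))
  rw [XSpace.norm_eq, XSpace.norm_eq, hA, hB, ENNReal.toReal_mul, ENNReal.toReal_mul,
    toReal_enorm, Real.mul_rpow (norm_nonneg _) ENNReal.toReal_nonneg,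
    Real.mul_rpow (norm_nonneg _) ENNReal.toReal_nonneg, ← mul_add,
    Real.mul_rpow (by positivity) (by positivity), ← Real.rpow_mul (norm_nonneg _),
    mul_one_div_cancel (by linarith), Real.rpow_one]

theorem XSpace.eq_zero_of_norm (u : XSpace Ω s p) (h : ‖u‖ = 0) : u = 0 := by
  have h1 : 1 < p := hp.out
  have hE : 0 ≤ gagliardoEnergy Ω s p u :=
    integral_nonneg fun z => gagliardoIntegrand_nonneg s p _ z
  have hP : 0 ≤ powIntegral Ω p u := integral_nonneg fun x => Real.rpow_nonneg (abs_nonneg _) _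
  rw [XSpace.norm_def, Real.rpow_eq_zero (add_nonneg hE hP) (by positivity)] at h
  have hE0 : gagliardoEnergy Ω s p u = 0 := by linarith
  have hP0 : powIntegral Ω p u = 0 := by linarith
  have hmΩ : MeasurableSet Ω.carrier := Ω.isOpen.measurableSet
  have hmQ : MeasurableSet (crossSet Ω) := (hmΩ.compl.prod hmΩ.compl).compl
  have a1 := (integral_eq_zero_iff_of_nonneg
    (fun z => gagliardoIntegrand_nonneg s p u z) u.2.1).1 hE0
  have a2 := (integral_eq_zero_iff_of_nonneg
    (fun x => Real.rpow_nonneg (abs_nonneg (u x)) p) u.2.2).1 hP0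
  rw [EventuallyEq, ae_restrict_iff' hmQ] at a1
  rw [EventuallyEq, ae_restrict_iff' hmΩ] at a2
  have a3 := Measure.ae_ae_of_ae_prod (μ := volume) (ν := volume) a1
  have hpos : volume Ω.carrier ≠ 0 := (Ω.isOpen.measure_pos _ Ω.isConnected.nonempty).ne'
  have hex : ∃ x ∈ Ω.carrier, u x = 0 ∧
      ∀ᵐ y, (x, y) ∈ crossSet Ω → gagliardoIntegrand s p u (x, y) = 0 := by
    by_contra hcon
    refine hpos (measure_mono_null ?_ (a2.and a3))
    intro x hx hx'
    have hx2 : u x = 0 := by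
      have := hx'.1 hx
      simpa [Real.rpow_eq_zero_iff_of_nonneg, (by linarith : p ≠ 0)] using this
    exact hcon ⟨x, hx, hx2, hx'.2⟩
  obtain ⟨x, hx, hx0, hy⟩ := hex
  apply Subtype.ext
  apply AEEqFun.ext
  refine EventuallyEq.trans ?_ AEEqFun.coeFn_zero.symm
  filter_upwards [hy] with y hy
  have := hy (by simp [crossSet, hx])
  by_cases hxy : x = y
  · exact hxy ▸ hx0
  have hne : ‖x - y‖ ^ ((N : ℝ) + p * s) ≠ 0 :=
    (Real.rpow_pos_of_pos (norm_pos_iff.2 (sub_ne_zero.2 hxy)) _).ne'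
  simp only [gagliardoIntegrand, div_eq_zero_iff, hne, or_false] at this
  rw [Real.rpow_eq_zero (abs_nonneg _) (by linarith), abs_eq_zero, hx0, zero_sub,
    neg_eq_zero] at this
  exact this

theorem XSpace.core : NormedSpace.Core ℝ (XSpace Ω s p) where
  norm_nonneg u := Real.rpow_nonneg (add_nonneg
    (integral_nonneg fun z => gagliardoIntegrand_nonneg s p _ z)
    (integral_nonneg fun x => Real.rpow_nonneg (abs_nonneg _) _)) _
  norm_smul := XSpace.norm_smul'
  norm_triangle := XSpace.norm_triangle
  norm_eq_zero_iff u := by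
    refine ⟨XSpace.eq_zero_of_norm u, fun h => ?_⟩
    have := XSpace.norm_smul' 0 u
    rw [zero_smul] at this
    rw [h, this, norm_zero, zero_mul]

noncomputable instance : NormedAddCommGroup (XSpace Ω s p) :=
  NormedAddCommGroup.ofCore XSpace.core

noncomputable instance : NormedSpace ℝ (XSpace Ω s p) :=
  NormedSpace.ofCore XSpace.core

end

/-- `g : Ω × ℝ → ℝ` is a Carathéodory function. -/
def IsCaratheodory (Ω : BoundedLipschitzDomain N) (g : EuclideanSpace ℝ (Fin N) → ℝ → ℝ) : Prop :=
  (∀ t, AEMeasurable (fun x => g x t) (volume.restrict Ω.carrier)) ∧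
    ∀ᵐ x ∂volume.restrict Ω.carrier, Continuous (g x)

/-- `G(x,t) = ∫_0^t g(x,τ) dτ`. -/
noncomputable def primitive (g : EuclideanSpace ℝ (Fin N) → ℝ → ℝ)
    (x : EuclideanSpace ℝ (Fin N)) (t : ℝ) : ℝ :=
  ∫ τ in (0 : ℝ)..t, g x τ

/-- Subcritical growth. -/
def CondG1 (Ω : BoundedLipschitzDomain N) (s p : ℝ)
    (g : EuclideanSpace ℝ (Fin N) → ℝ → ℝ) : Prop :=
  ∃ a₁ a₂ q : ℝ, 0 < a₁ ∧ 0 < a₂ ∧ p < q ∧ (p * s < N → q < p * N / (N - p * s)) ∧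
    ∀ᵐ x ∂volume.restrict Ω.carrier, ∀ t : ℝ, |g x t| ≤ a₁ + a₂ * |t| ^ (q - 1)

/-- `g(x,t) = o(|t|^{p-1})` as `t → 0`, uniformly for a.e. `x ∈ Ω`. -/
def CondG2 (Ω : BoundedLipschitzDomain N) (p : ℝ)
    (g : EuclideanSpace ℝ (Fin N) → ℝ → ℝ) : Prop :=
  ∀ ε > 0, ∃ δ > 0, ∀ᵐ x ∂volume.restrict Ω.carrier, ∀ t : ℝ, 0 < |t| → |t| < δ →
    |g x t| ≤ ε * |t| ^ (p - 1)

/-- The Ambrosetti–Rabinowitz condition with threshold `R`, together with the global lower bound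
on `G`. -/
def CondG3 (Ω : BoundedLipschitzDomain N) (p : ℝ)
    (g : EuclideanSpace ℝ (Fin N) → ℝ → ℝ) (R : ℝ) : Prop :=
  (∃ μ : ℝ, p < μ ∧ ∀ᵐ x ∂volume.restrict Ω.carrier, ∀ t : ℝ, R < |t| →
      0 < μ * primitive g x t ∧ μ * primitive g x t ≤ g x t * t) ∧
    ∃ (μ' a₃ : ℝ) (a₄ : EuclideanSpace ℝ (Fin N) → ℝ), p < μ' ∧ 0 < a₃ ∧
      IntegrableOn a₄ Ω.carrier ∧
      ∀ᵐ x ∂volume.restrict Ω.carrier, ∀ t : ℝ, a₃ * |t| ^ μ' - a₄ x ≤ primitive g x t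

/-- If `R > 0`, then `G ≥ 0`. -/
def CondG4 (Ω : BoundedLipschitzDomain N)
    (g : EuclideanSpace ℝ (Fin N) → ℝ → ℝ) (R : ℝ) : Prop :=
  0 < R → ∀ᵐ x ∂volume.restrict Ω.carrier, ∀ t : ℝ, 0 ≤ primitive g x t

/-- `I(u) = (1/2p) [u]^p - (lam/p) ∫_Ω |u|^p dx - ∫_Ω G(x,u) dx`. -/
noncomputable def energyFunctional (Ω : BoundedLipschitzDomain N) (s p : ℝ) [Fact (1 < p)]
    (lam : ℝ) (g : EuclideanSpace ℝ (Fin N) → ℝ → ℝ) (u : XSpace Ω s p) : ℝ :=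
  1 / (2 * p) * gagliardoEnergy Ω s p u - lam / p * powIntegral Ω p u
    - ∫ x in Ω.carrier, primitive g x (u x)

end FracNeumann

/-- The Palais–Smale condition at level `c` (for differentiable `f`): every sequence `u` with
`f (u n) → c` and `f' (u n) → 0` in the dual space has a strongly convergent subsequence. -/
def PalaisSmaleAt {E : Type*} [NormedAddCommGroup E] [NormedSpace ℝ E] (f : E → ℝ) (c : ℝ) : Prop :=
  ∀ u : ℕ → E, Tendsto (fun n => f (u n)) atTop (𝓝 c) →
    Tendsto (fun n => fderiv ℝ f (u n)) atTop (𝓝 0) →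
    ∃ (w : E) (φ : ℕ → ℕ), StrictMono φ ∧ Tendsto (fun n => u (φ n)) atTop (𝓝 w)

/-!
The functional has the form `I(u) = ‖Du‖^p / 2p - J(Tu)`, where `D : X → L^p(𝒬)` is the difference
quotient operator, `T : X → L^q(Ω)` is the Sobolev embedding, and `J(v) = ∫_Ω ∫₀^v f(x,τ) dτ dx`
with `f(x,t) = g(x,t) + λ |t|^{p-2} t`, so that the `λ`-term counts as part of the nonlinearity.

*Regularity.* Both summands are integral functionals on an `L^q` space, with an integrand of growth
`q - 1`. The superposition operator `L^q → L^{q'}` of such an integrand is continuous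
(`PowerGrowth.continuous_nemytskii`), so the Gateaux derivative is continuous and the functional is
`C¹` (`PowerGrowth.contDiff`).

*Compactness of `T`* (`exists_compact_embedding`). The Lipschitz boundary enters only through the
measure density condition `|Ω ∩ B(x,r)| ≥ c r^N` (`exists_measure_density`). Replace `u` near `x` by
its average over `Ω ∩ B(π x, r)`, with `π x` the nearest point of a finite `r`-net. These
operators have finite rank, and the difference of those at the scales `r` and `r / 2` has norm at
most `C r^θ` from `X` to `L^q(Ω)`, with `θ = s - N/p + N/q > 0` for subcritical `q`: by Jensen's
inequality its `p`-th power is dominated by a local integral of the Gagliardo density, for which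
the supremum and the integral over `Ω` are both under control. So they converge in operator norm.

*The Palais–Smale condition* (`palaisSmaleAt_modelFunctional`). The Ambrosetti–Rabinowitz condition
bounds `κ ‖u‖^p` by `I(u) - σ⁻¹ I'(u)u` up to a constant; the superlinear lower bound on `G` absorbs
the `λ`-term, whatever the size of `λ`. So a Palais–Smale sequence is bounded, and along a
subsequence `T u_n` converges. Testing `I'(u_n) - I'(u_m)` with `u_n - u_m` shows that
`⟨Ψ'(Du_n) - Ψ'(Du_m), Du_n - Du_m⟩ → 0`, where `Ψ = ‖·‖^p`. By strict monotonicity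
(`exists_abs_sub_rpow_le`), `Du_n` is then a Cauchy sequence in `L^p(𝒬)`, hence so is `u_n` in `X`,
which is complete. No weak convergence is needed.
-/

namespace FracNeumann

/-! ### Integral functionals on `L^q` -/

section Nemytskii

variable {α : Type*} [MeasurableSpace α] {μ : Measure α}

instance fact_one_le_ofReal {q : ℝ} [hq : Fact (1 < q)] : Fact (1 ≤ ENNReal.ofReal q) :=
  ⟨by simpa using hq.out.le⟩

theorem one_lt_conjExponent {q : ℝ} (hq : 1 < q) : 1 < q.conjExponent :=
  (Real.HolderConjugate.conjExponent hq).symm.lt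

instance fact_one_lt_conjExponent {q : ℝ} [hq : Fact (1 < q)] : Fact (1 < q.conjExponent) :=
  ⟨one_lt_conjExponent hq.out⟩

instance holderConjugate_ofReal {q : ℝ} [hq : Fact (1 < q)] :
    ENNReal.HolderConjugate (ENNReal.ofReal q.conjExponent) (ENNReal.ofReal q) :=
  (Real.HolderConjugate.conjExponent hq.out).symm.ennrealOfReal

theorem ofReal_ne_zero_of_one_lt {q : ℝ} (hq : 1 < q) : ENNReal.ofReal q ≠ 0 := by
  simp; linarith

theorem toReal_ofReal_of_one_lt {q : ℝ} (hq : 1 < q) : (ENNReal.ofReal q).toReal = q :=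
  ENNReal.toReal_ofReal (by linarith)

theorem conj_mul_sub_one {q : ℝ} (hq : 1 < q) : (q - 1) * q.conjExponent = q := by
  rw [Real.conjExponent, mul_div_cancel₀ _ (by linarith : q - 1 ≠ 0)]

/-- A quasi-triangle inequality, with a crude constant that is valid for all `r ≥ 0`. -/
theorem add_rpow_le_two_rpow {x y r : ℝ} (hx : 0 ≤ x) (hy : 0 ≤ y) (hr : 0 ≤ r) :
    (x + y) ^ r ≤ 2 ^ r * (x ^ r + y ^ r) := by
  have h1 : (x + y) ^ r ≤ (2 * max x y) ^ r := by
    refine Real.rpow_le_rpow (by positivity) ?_ hr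
    linarith [le_max_left x y, le_max_right x y]
  refine h1.trans ?_
  rw [Real.mul_rpow (by norm_num) (by positivity)]
  refine mul_le_mul_of_nonneg_left ?_ (by positivity)
  rcases max_cases x y with h | h <;> rw [h.1]
  · linarith [Real.rpow_nonneg hy r]
  · linarith [Real.rpow_nonneg hx r]

/-- A function `f : α × ℝ → ℝ` satisfying the Carathéodory conditions and the growth bound
`|f(x,t)| ≤ a(x) + b |t|^{q-1}` with `a` in `L^{q'}`. -/
structure PowerGrowth (μ : Measure α) (q : ℝ) (f : α → ℝ → ℝ) : Prop where
  aemeasurable : ∀ t, AEMeasurable (fun x => f x t) μ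
  continuous : ∀ᵐ x ∂μ, Continuous (f x)
  bound : ∃ (a : α → ℝ) (b : ℝ), 0 ≤ b ∧ MemLp a (ENNReal.ofReal q.conjExponent) μ ∧
    ∀ᵐ x ∂μ, ∀ t, |f x t| ≤ a x + b * |t| ^ (q - 1)

/-- A Carathéodory function agrees, off a null set, with one that is continuous in the second
variable at every point and measurable in the first for every value of the second. -/
theorem exists_measurable_caratheodory {f : α → ℝ → ℝ}
    (hm : ∀ t, AEMeasurable (fun x => f x t) μ) (hc : ∀ᵐ x ∂μ, Continuous (f x)) :
    ∃ f' : α → ℝ → ℝ, (∀ x, Continuous (f' x)) ∧ (∀ t, Measurable fun x => f' x t) ∧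
      ∀ᵐ x ∂μ, f x = f' x := by
  have hae : ∀ᵐ x ∂μ, Continuous (f x) ∧ ∀ r : ℚ, f x r = (hm r).mk _ x :=
    hc.and (ae_all_iff.2 fun r => (hm r).ae_eq_mk)
  set S : Set α := {x | Continuous (f x) ∧ ∀ r : ℚ, f x r = (hm r).mk _ x} with hS
  -- Off the measurable null set `Z`, `f x` is continuous and its values at rational points are
  -- those of measurable functions of `x`.
  set Z : Set α := toMeasurable μ Sᶜ with hZ
  have hZm : MeasurableSet Z := measurableSet_toMeasurable _ _
  have hZ0 : μ Z = 0 := by rw [hZ, measure_toMeasurable]; exact hae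
  have hmem : ∀ x, x ∉ Z → x ∈ S := fun x hx => by
    by_contra h
    exact hx (subset_toMeasurable _ _ h)
  classical
  let f' : α → ℝ → ℝ := fun x t => if x ∈ Z then 0 else f x t
  have hcont : ∀ x, Continuous (f' x) := by
    intro x
    by_cases hx : x ∈ Z
    · simp only [f', hx, if_true]; exact continuous_const
    · simp only [f', hx, if_false]; exact (hmem x hx).1
  refine ⟨f', hcont, ?_, ?_⟩
  · have hrat : ∀ r : ℚ, Measurable fun x => f' x r := by
      intro r
      have : (fun x => f' x r) = Zᶜ.indicator ((hm r).mk _) := by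
        funext x
        by_cases hx : x ∈ Z
        · simp [f', hx]
        · simp [f', hx, (hmem x hx).2 r]
      rw [this]
      exact (hm r).measurable_mk.indicator hZm.compl
    intro t
    obtain ⟨r, -, hr⟩ := Real.exists_seq_rat_strictMono_tendsto t
    refine measurable_of_tendsto_metrizable (fun n => hrat (r n)) ?_
    rw [tendsto_pi_nhds]
    exact fun x => ((hcont x).tendsto t).comp hr.2
  · have : ∀ᵐ x ∂μ, x ∉ Z := measure_eq_zero_iff_ae_notMem.1 hZ0
    filter_upwards [this] with x hx
    funext t
    simp [f', hx]

theorem measurable_uncurry_caratheodory {f : α → ℝ → ℝ} (hc : ∀ x, Continuous (f x))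
    (hm : ∀ t, Measurable fun x => f x t) : Measurable fun z : ℝ × α => f z.2 z.1 :=
  (stronglyMeasurable_uncurry_of_continuous_of_stronglyMeasurable
    (u := fun (t : ℝ) (x : α) => f x t) hc fun t => (hm t).stronglyMeasurable).measurable

theorem aestronglyMeasurable_comp_caratheodory {f : α → ℝ → ℝ}
    (hm : ∀ t, AEMeasurable (fun x => f x t) μ) (hc : ∀ᵐ x ∂μ, Continuous (f x))
    {u : α → ℝ} (hu : AEStronglyMeasurable u μ) :
    AEStronglyMeasurable (fun x => f x (u x)) μ := by
  obtain ⟨f', hc', hm', hff'⟩ := exists_measurable_caratheodory hm hc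
  have h := (measurable_uncurry_caratheodory hc' hm').comp_aemeasurable
    (hu.aemeasurable.prodMk aemeasurable_id)
  refine h.aestronglyMeasurable.congr ?_
  filter_upwards [hff'] with x hx
  simp [hx]

theorem aestronglyMeasurable_primitive {f : α → ℝ → ℝ}
    (hm : ∀ t, AEMeasurable (fun x => f x t) μ) (hc : ∀ᵐ x ∂μ, Continuous (f x))
    {u : α → ℝ} (hu : AEStronglyMeasurable u μ) :
    AEStronglyMeasurable (fun x => ∫ τ in (0 : ℝ)..u x, f x τ) μ := by
  obtain ⟨f', hc', hm', hff'⟩ := exists_measurable_caratheodory hm hc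
  have hms := (measurable_uncurry_caratheodory hc' hm').stronglyMeasurable
  have hF : ∀ t : ℝ, Measurable fun x => ∫ τ in (0 : ℝ)..t, f' x τ := by
    intro t
    simp only [intervalIntegral]
    exact (hms.integral_prod_left (μ := volume.restrict (Ioc 0 t))).measurable.sub
      (hms.integral_prod_left (μ := volume.restrict (Ioc t 0))).measurable
  have hFc : ∀ x, Continuous fun t : ℝ => ∫ τ in (0 : ℝ)..t, f' x τ := fun x =>
    intervalIntegral.continuous_primitive (fun a b => (hc' x).intervalIntegrable a b) 0
  refine (aestronglyMeasurable_comp_caratheodory (fun t => (hF t).aemeasurable)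
    (Eventually.of_forall hFc) hu).congr ?_
  filter_upwards [hff'] with x hx
  simp [hx]

theorem PowerGrowth.exists_nonneg_bound {q : ℝ} {f : α → ℝ → ℝ} (hf : PowerGrowth μ q f) :
    ∃ (a : α → ℝ) (b : ℝ), (∀ x, 0 ≤ a x) ∧ 0 ≤ b ∧
      MemLp a (ENNReal.ofReal q.conjExponent) μ ∧
      ∀ᵐ x ∂μ, ∀ t, |f x t| ≤ a x + b * |t| ^ (q - 1) := by
  obtain ⟨a, b, hb, ha, h⟩ := hf.bound
  refine ⟨fun x => |a x|, b, fun x => abs_nonneg _, hb, ha.abs, ?_⟩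
  filter_upwards [h] with x hx t
  exact (hx t).trans (by gcongr; exact le_abs_self _)

theorem abs_primitive_le_of_bound {φ : ℝ → ℝ} {a b q : ℝ} (hb : 0 ≤ b) (hq : 1 < q)
    (h : ∀ t, |φ t| ≤ a + b * |t| ^ (q - 1)) (t : ℝ) :
    |∫ τ in (0 : ℝ)..t, φ τ| ≤ (a + b * |t| ^ (q - 1)) * |t| := by
  have := intervalIntegral.norm_integral_le_of_norm_le_const (a := 0) (b := t) (f := φ)
    (C := a + b * |t| ^ (q - 1)) (fun τ hτ => (h τ).trans ?_)
  · simpa using this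
  · have : |τ| ≤ |t| := by
      rcases le_total 0 t with h0 | h0
      · rw [uIoc_of_le h0] at hτ
        rw [abs_of_pos hτ.1, abs_of_nonneg h0]; exact hτ.2
      · rw [uIoc_of_ge h0] at hτ
        rw [abs_of_nonpos hτ.2, abs_of_nonpos h0]; linarith [hτ.1]
    gcongr

theorem integrable_abs_rpow {r : ℝ} (hr : 1 < r) {u : α → ℝ} (hu : MemLp u (ENNReal.ofReal r) μ) :
    Integrable (fun x => |u x| ^ r) μ := by
  have := hu.integrable_norm_rpow (ofReal_ne_zero_of_one_lt hr) ENNReal.ofReal_ne_top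
  rwa [toReal_ofReal_of_one_lt hr] at this

variable {q : ℝ} [hq : Fact (1 < q)] {f : α → ℝ → ℝ}

theorem memLp_abs_rpow_sub_one {u : α → ℝ} (hu : MemLp u (ENNReal.ofReal q) μ) :
    MemLp (fun x => |u x| ^ (q - 1)) (ENNReal.ofReal q.conjExponent) μ := by
  have h1 := hq.out
  have h := hu.norm_rpow_div (ENNReal.ofReal (q - 1))
  rw [ENNReal.toReal_ofReal (by linarith), ← ENNReal.ofReal_div_of_pos (by linarith)] at h
  exact h

theorem PowerGrowth.memLp (hf : PowerGrowth μ q f) {u : α → ℝ}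
    (hu : MemLp u (ENNReal.ofReal q) μ) :
    MemLp (fun x => f x (u x)) (ENNReal.ofReal q.conjExponent) μ := by
  obtain ⟨a, b, hb, ha, h⟩ := hf.bound
  refine (ha.add ((memLp_abs_rpow_sub_one hu).const_mul b)).mono
    (aestronglyMeasurable_comp_caratheodory hf.aemeasurable hf.continuous hu.1) ?_
  filter_upwards [h] with x hx
  rw [Real.norm_eq_abs, Real.norm_eq_abs]
  exact (hx _).trans (le_abs_self _)

theorem integrable_mul_of_memLp_conj {u v : α → ℝ}
    (hu : MemLp u (ENNReal.ofReal q.conjExponent) μ) (hv : MemLp v (ENNReal.ofReal q) μ) :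
    Integrable (fun x => u x * v x) μ :=
  hu.integrable_mul hv

theorem PowerGrowth.integrable_primitive (hf : PowerGrowth μ q f) {u : α → ℝ}
    (hu : MemLp u (ENNReal.ofReal q) μ) :
    Integrable (fun x => ∫ τ in (0 : ℝ)..u x, f x τ) μ := by
  obtain ⟨a, b, hb, ha, h⟩ := hf.bound
  refine (integrable_mul_of_memLp_conj
    (ha.add ((memLp_abs_rpow_sub_one hu).const_mul b)) hu).mono
    (aestronglyMeasurable_primitive hf.aemeasurable hf.continuous hu.1) ?_
  filter_upwards [h] with x hx
  rw [Real.norm_eq_abs, Real.norm_eq_abs, abs_mul]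
  refine (abs_primitive_le_of_bound hb hq.out hx _).trans ?_
  gcongr
  exact le_abs_self _

/-- The superposition operator `u ↦ f(·,u)` from `L^q` to `L^{q'}`. -/
noncomputable def PowerGrowth.nemytskii (hf : PowerGrowth μ q f) (u : Lp ℝ (ENNReal.ofReal q) μ) :
    Lp ℝ (ENNReal.ofReal q.conjExponent) μ :=
  (hf.memLp (Lp.memLp u)).toLp _

theorem PowerGrowth.coeFn_nemytskii (hf : PowerGrowth μ q f) (u : Lp ℝ (ENNReal.ofReal q) μ) :
    hf.nemytskii u =ᵐ[μ] fun x => f x (u x) :=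
  MemLp.coeFn_toLp _

theorem norm_Lp_rpow (u : Lp ℝ (ENNReal.ofReal q) μ) : ‖u‖ ^ q = ∫ x, |u x| ^ q ∂μ := by
  rw [Lp.norm_def, rpow_eLpNorm (Lp.memLp u)]
  rfl

theorem tendsto_Lp_iff_integral {ι : Type*} {l : Filter ι} {u : ι → Lp ℝ (ENNReal.ofReal q) μ}
    {w : Lp ℝ (ENNReal.ofReal q) μ} :
    Tendsto u l (𝓝 w) ↔ Tendsto (fun n => ∫ x, |u n x - w x| ^ q ∂μ) l (𝓝 0) := by
  have h1 := hq.out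
  have key : ∀ n, ∫ x, |u n x - w x| ^ q ∂μ = ‖u n - w‖ ^ q := fun n => by
    rw [norm_Lp_rpow]
    refine integral_congr_ae ?_
    filter_upwards [Lp.coeFn_sub (u n) w] with x hx
    rw [hx, Pi.sub_apply]
  simp only [key]
  rw [tendsto_iff_norm_sub_tendsto_zero]
  constructor
  · intro h
    have := h.rpow_const (p := q) (Or.inr (by linarith))
    rwa [Real.zero_rpow (by linarith)] at this
  · intro h
    have := h.rpow_const (p := 1 / q) (Or.inr (by positivity))
    rw [Real.zero_rpow (by positivity)] at this
    refine this.congr fun n => ?_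
    rw [← Real.rpow_mul (norm_nonneg _), mul_one_div_cancel (by linarith), Real.rpow_one]


/-- The increment of `f(x,·)` from `u(x)`, in the power `q'`, is bounded by a fixed integrable
function plus a multiple of the `q`-th power of the increment of the argument. -/
theorem PowerGrowth.exists_sub_bound (hf : PowerGrowth μ q f) {u : α → ℝ}
    (hu : MemLp u (ENNReal.ofReal q) μ) :
    ∃ (H : α → ℝ) (C : ℝ), 0 ≤ C ∧ (∀ x, 0 ≤ H x) ∧ Integrable H μ ∧ ∀ᵐ x ∂μ, ∀ t,
      |f x t - f x (u x)| ^ q.conjExponent ≤ H x + C * |t - u x| ^ q := by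
  have h1 := hq.out
  have h1' := one_lt_conjExponent h1
  obtain ⟨a, b, ha0, hb, ha, h⟩ := hf.exists_nonneg_bound
  set A : α → ℝ := fun x => 2 * a x + b * (1 + 2 ^ (q - 1)) * |u x| ^ (q - 1) with hA
  set B : ℝ := b * 2 ^ (q - 1) with hB
  have hA0 : ∀ x, 0 ≤ A x := fun x => by have := ha0 x; positivity
  have hAm : MemLp A (ENNReal.ofReal q.conjExponent) μ :=
    (ha.const_mul 2).add ((memLp_abs_rpow_sub_one hu).const_mul _)
  refine ⟨fun x => 2 ^ q.conjExponent * |A x| ^ q.conjExponent,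
    2 ^ q.conjExponent * B ^ q.conjExponent, by positivity, fun x => by positivity,
    (integrable_abs_rpow h1' hAm).const_mul _, ?_⟩
  filter_upwards [h] with x hx t
  have e1 : |t| ^ (q - 1) ≤ 2 ^ (q - 1) * (|u x| ^ (q - 1) + |t - u x| ^ (q - 1)) := by
    refine le_trans ?_ (add_rpow_le_two_rpow (abs_nonneg _) (abs_nonneg _) (by linarith))
    refine Real.rpow_le_rpow (abs_nonneg _) ?_ (by linarith)
    have := abs_add_le (u x) (t - u x)
    simpa using this
  have e2 : |f x t - f x (u x)| ≤ A x + B * |t - u x| ^ (q - 1) := by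
    have := abs_sub (f x t) (f x (u x))
    have h3 := hx t
    have h4 := hx (u x)
    have h5 := mul_le_mul_of_nonneg_left e1 hb
    simp only [hA, hB]
    nlinarith
  calc |f x t - f x (u x)| ^ q.conjExponent
      ≤ (A x + B * |t - u x| ^ (q - 1)) ^ q.conjExponent :=
        Real.rpow_le_rpow (abs_nonneg _) e2 (by linarith)
    _ ≤ 2 ^ q.conjExponent * (A x ^ q.conjExponent +
          (B * |t - u x| ^ (q - 1)) ^ q.conjExponent) :=
        add_rpow_le_two_rpow (hA0 x) (by positivity) (by linarith)
    _ = _ := by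
        rw [Real.mul_rpow (by positivity) (by positivity), ← Real.rpow_mul (abs_nonneg _),
          conj_mul_sub_one h1, abs_of_nonneg (hA0 x)]
        ring

theorem integrable_abs_sub_rpow (u w : Lp ℝ (ENNReal.ofReal q) μ) :
    Integrable (fun x => |u x - w x| ^ q) μ :=
  integrable_abs_rpow hq.out ((Lp.memLp u).sub (Lp.memLp w))

theorem PowerGrowth.tendsto_nemytskii_of_ae (hf : PowerGrowth μ q f)
    {u : ℕ → Lp ℝ (ENNReal.ofReal q) μ} {w : Lp ℝ (ENNReal.ofReal q) μ}
    (hu : Tendsto u atTop (𝓝 w)) (hae : ∀ᵐ x ∂μ, Tendsto (fun n => u n x) atTop (𝓝 (w x))) :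
    Tendsto (fun n => hf.nemytskii (u n)) atTop (𝓝 (hf.nemytskii w)) := by
  have h1 := hq.out
  have h1' := one_lt_conjExponent h1
  rw [tendsto_Lp_iff_integral] at hu ⊢
  obtain ⟨H, C, hC, hH0, hH, hb⟩ := hf.exists_sub_bound (Lp.memLp w)
  -- The part of the integrand above `C |u_n - w|^q` is dominated by `H`.
  have hint : ∀ n, Integrable (fun x => |f x (u n x) - f x (w x)| ^ q.conjExponent) μ := fun n =>
    integrable_abs_rpow h1' ((hf.memLp (Lp.memLp (u n))).sub (hf.memLp (Lp.memLp w)))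
  have hd : ∀ n, Integrable (fun x => C * |u n x - w x| ^ q) μ := fun n =>
    (integrable_abs_sub_rpow _ _).const_mul C
  set m : ℕ → α → ℝ := fun n x =>
    max (|f x (u n x) - f x (w x)| ^ q.conjExponent - C * |u n x - w x| ^ q) 0 with hm
  have hmi : ∀ n, Integrable (m n) μ := fun n => ((hint n).sub (hd n)).pos_part
  have hmt : Tendsto (fun n => ∫ x, m n x ∂μ) atTop (𝓝 0) := by
    have := tendsto_integral_of_dominated_convergence (F := m) (f := fun _ => 0) (μ := μ) H
      (fun n => (hmi n).1) hH (fun n => ?_) ?_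
    · simpa using this
    · filter_upwards [hb] with x hx
      rw [Real.norm_eq_abs, abs_of_nonneg (le_max_right _ _)]
      exact max_le (by linarith [hx (u n x)]) (hH0 x)
    · filter_upwards [hae, hf.continuous] with x hx hcx
      have t1 : Tendsto (fun n => |f x (u n x) - f x (w x)| ^ q.conjExponent) atTop (𝓝 0) := by
        have := (((hcx.tendsto (w x)).comp hx).sub_const (f x (w x))).abs.rpow_const
          (p := q.conjExponent) (Or.inr (by linarith))
        simpa [Real.zero_rpow (by linarith : q.conjExponent ≠ 0)] using this
      have t2 : Tendsto (fun n => C * |u n x - w x| ^ q) atTop (𝓝 0) := by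
        have := ((hx.sub_const (w x)).abs.rpow_const (p := q) (Or.inr (by linarith))).const_mul C
        simpa [Real.zero_rpow (by linarith : q ≠ 0)] using this
      have := (t1.sub t2).max (tendsto_const_nhds (x := (0 : ℝ)))
      simpa using this
  have hsum : Tendsto (fun n => ∫ x, m n x ∂μ + C * ∫ x, |u n x - w x| ^ q ∂μ) atTop (𝓝 0) := by
    simpa using hmt.add (hu.const_mul C)
  refine squeeze_zero (fun n => integral_nonneg fun x => by positivity) (fun n => ?_) hsum
  rw [← integral_const_mul, ← integral_add (hmi n) (hd n)]
  have e : ∫ x, |hf.nemytskii (u n) x - hf.nemytskii w x| ^ q.conjExponent ∂μ =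
      ∫ x, |f x (u n x) - f x (w x)| ^ q.conjExponent ∂μ := by
    refine integral_congr_ae ?_
    filter_upwards [hf.coeFn_nemytskii (u n), hf.coeFn_nemytskii w] with x hx hy
    rw [hx, hy]
  rw [e]
  refine integral_mono (hint n) ((hmi n).add (hd n)) fun x => ?_
  simp only [hm]
  linarith [le_max_left (|f x (u n x) - f x (w x)| ^ q.conjExponent - C * |u n x - w x| ^ q) 0]

theorem PowerGrowth.continuous_nemytskii (hf : PowerGrowth μ q f) :
    Continuous hf.nemytskii := by
  rw [continuous_iff_seqContinuous]
  intro u w hu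
  refine tendsto_of_subseq_tendsto fun ns hns => ?_
  have h1 : Tendsto (fun n => u (ns n)) atTop (𝓝 w) := hu.comp hns
  obtain ⟨ms, hms, hae⟩ := (tendstoInMeasure_of_tendsto_Lp h1).exists_seq_tendsto_ae
  exact ⟨ms, hf.tendsto_nemytskii_of_ae (h1.comp hms.tendsto_atTop) hae⟩

/-- The integral functional `u ↦ ∫ F(x,u(x)) dx`, where `F(x,t) = ∫₀ᵗ f(x,τ) dτ`. -/
noncomputable def integralFunctional (μ : Measure α) (f : α → ℝ → ℝ)
    (u : Lp ℝ (ENNReal.ofReal q) μ) : ℝ :=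
  ∫ x, (∫ τ in (0 : ℝ)..u x, f x τ) ∂μ

/-- The derivative `h ↦ ∫ f(x,u(x)) h(x) dx` of the integral functional. -/
noncomputable def PowerGrowth.deriv (hf : PowerGrowth μ q f) (u : Lp ℝ (ENNReal.ofReal q) μ) :
    Lp ℝ (ENNReal.ofReal q) μ →L[ℝ] ℝ :=
  (ContinuousLinearMap.mul ℝ ℝ).lpPairing μ (ENNReal.ofReal q.conjExponent) (ENNReal.ofReal q)
    (hf.nemytskii u)

theorem PowerGrowth.deriv_apply (hf : PowerGrowth μ q f) (u h : Lp ℝ (ENNReal.ofReal q) μ) :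
    hf.deriv u h = ∫ x, f x (u x) * h x ∂μ := by
  rw [PowerGrowth.deriv, ContinuousLinearMap.lpPairing_eq_integral]
  refine integral_congr_ae ?_
  filter_upwards [hf.coeFn_nemytskii u] with x hx
  simp [hx]

theorem PowerGrowth.continuous_deriv (hf : PowerGrowth μ q f) : Continuous hf.deriv :=
  (ContinuousLinearMap.continuous _).comp hf.continuous_nemytskii

theorem PowerGrowth.hasDerivAt_line (hf : PowerGrowth μ q f) (u h : Lp ℝ (ENNReal.ofReal q) μ) :
    HasDerivAt (fun t : ℝ => integralFunctional μ f (u + t • h)) (hf.deriv u h) 0 := by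
  have h1 := hq.out
  obtain ⟨a, b, ha0, hb, ha, hbd⟩ := hf.exists_nonneg_bound
  have hum := Lp.memLp u
  have hhm := Lp.memLp h
  have hline : ∀ t : ℝ, MemLp (fun x => u x + t * h x) (ENNReal.ofReal q) μ := fun t =>
    hum.add (hhm.const_mul t)
  have e : (fun t : ℝ => integralFunctional μ f (u + t • h)) =
      fun t : ℝ => ∫ x, (∫ τ in (0 : ℝ)..(u x + t * h x), f x τ) ∂μ := by
    funext t
    refine integral_congr_ae ?_
    filter_upwards [Lp.coeFn_add u (t • h), Lp.coeFn_smul t h] with x hx hy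
    rw [hx, Pi.add_apply, hy, Pi.smul_apply, smul_eq_mul]
  rw [e, hf.deriv_apply]
  have hv : MemLp (fun x => |u x| + |h x|) (ENNReal.ofReal q) μ := hum.abs.add hhm.abs
  have key := hasDerivAt_integral_of_dominated_loc_of_deriv_le (μ := μ) (x₀ := (0 : ℝ))
    (s := Metric.ball 0 1) (F := fun t x => ∫ τ in (0 : ℝ)..(u x + t * h x), f x τ)
    (F' := fun t x => f x (u x + t * h x) * h x)
    (bound := fun x => (a x + b * |(|u x| + |h x|)| ^ (q - 1)) * |h x|)
    (Metric.ball_mem_nhds _ one_pos)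
    (Eventually.of_forall fun t => (hf.integrable_primitive (hline t)).1)
    (hf.integrable_primitive (hline 0))
    (integrable_mul_of_memLp_conj (hf.memLp (hline 0)) hhm).1 ?_
    (integrable_mul_of_memLp_conj (ha.add ((memLp_abs_rpow_sub_one hv).const_mul b)) hhm.abs) ?_
  · simpa using key.2
  · filter_upwards [hbd] with x hx t ht
    rw [Real.norm_eq_abs, abs_mul]
    refine mul_le_mul_of_nonneg_right ((hx _).trans ?_) (abs_nonneg _)
    have ht' : |t| ≤ 1 := by simpa using (mem_ball_zero_iff.1 ht).le
    have h3 : |u x + t * h x| ≤ |(|u x| + |h x|)| := by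
      rw [abs_of_nonneg (by positivity : 0 ≤ |u x| + |h x|)]
      refine (abs_add_le _ _).trans ?_
      rw [abs_mul]
      have := mul_le_mul_of_nonneg_right ht' (abs_nonneg (h x))
      linarith
    gcongr
  · filter_upwards [hf.continuous] with x hx t _
    have h2 : HasDerivAt (fun r : ℝ => ∫ τ in (0 : ℝ)..r, f x τ) (f x (u x + t * h x))
        (u x + t * h x) :=
      intervalIntegral.integral_hasDerivAt_right (hx.intervalIntegrable _ _)
        (hx.stronglyMeasurableAtFilter _ _) hx.continuousAt
    have h3 : HasDerivAt (fun t : ℝ => u x + t * h x) (h x) t := by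
      simpa using ((hasDerivAt_id t).mul_const (h x)).const_add (u x)
    exact h2.comp t h3

/-- A function whose Gateaux derivative is linear and depends continuously on the point is
Fréchet differentiable. -/
theorem hasFDerivAt_of_continuous_gateaux {E : Type*} [NormedAddCommGroup E] [NormedSpace ℝ E]
    {J : E → ℝ} {J' : E → E →L[ℝ] ℝ} (hJ' : Continuous J')
    (hJ : ∀ u h, HasDerivAt (fun t : ℝ => J (u + t • h)) (J' u h) 0) (u : E) :
    HasFDerivAt J (J' u) u := by
  have hd : ∀ (h : E) (t : ℝ), HasDerivAt (fun t : ℝ => J (u + t • h)) (J' (u + t • h) h) t := by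
    intro h t
    have h0 := hJ (u + t • h) h
    have h1 : HasDerivAt (fun r : ℝ => r - t) 1 t := (hasDerivAt_id t).sub_const t
    have h2 := HasDerivAt.comp t (by simpa using h0) h1
    refine (h2.congr_of_eventuallyEq (Eventually.of_forall fun r => ?_)).congr_deriv (mul_one _)
    simp only [Function.comp_apply]
    congr 1
    rw [sub_smul]
    abel
  rw [hasFDerivAt_iff_isLittleO_nhds_zero, Asymptotics.isLittleO_iff]
  intro ε hε
  obtain ⟨δ, hδ, hball⟩ := Metric.continuousAt_iff.1 hJ'.continuousAt ε hε
  filter_upwards [Metric.ball_mem_nhds (0 : E) hδ] with h hh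
  obtain ⟨c, hc, hslope⟩ := exists_hasDerivAt_eq_slope (fun t : ℝ => J (u + t • h))
    (fun t => J' (u + t • h) h) one_pos
    (fun t _ => (hd h t).continuousAt.continuousWithinAt) fun t _ => hd h t
  simp only [one_smul, zero_smul, add_zero, sub_zero, div_one] at hslope
  rw [← hslope, ← sub_apply]
  refine (ContinuousLinearMap.le_opNorm _ _).trans (mul_le_mul_of_nonneg_right ?_ (norm_nonneg _))
  have := hball (x := u + c • h) (by
    rw [dist_eq_norm, add_sub_cancel_left, norm_smul, Real.norm_eq_abs, abs_of_pos hc.1]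
    have := mem_ball_zero_iff.1 hh
    nlinarith [hc.2, norm_nonneg h])
  rw [dist_eq_norm] at this
  exact this.le

theorem PowerGrowth.hasFDerivAt (hf : PowerGrowth μ q f) (u : Lp ℝ (ENNReal.ofReal q) μ) :
    HasFDerivAt (integralFunctional μ f) (hf.deriv u) u :=
  hasFDerivAt_of_continuous_gateaux hf.continuous_deriv hf.hasDerivAt_line u

theorem PowerGrowth.contDiff (hf : PowerGrowth μ q f) :
    ContDiff ℝ 1 (integralFunctional (q := q) μ f) :=
  contDiff_one_iff_hasFDerivAt.2 ⟨hf.deriv, hf.continuous_deriv, hf.hasFDerivAt⟩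

end Nemytskii

/-! ### The power `|t|^p` and its derivative -/

section SignedPower

/-- The derivative `p |t|^{p-2} t` of `|t|^p`. -/
noncomputable def absRpowDeriv (p t : ℝ) : ℝ := p * |t| ^ (p - 2) * t

theorem hasDerivAt_abs_rpow' {p : ℝ} (hp : 1 < p) (t : ℝ) :
    HasDerivAt (fun t : ℝ => |t| ^ p) (absRpowDeriv p t) t :=
  hasDerivAt_abs_rpow t hp

theorem continuous_absRpowDeriv {p : ℝ} (hp : 1 < p) : Continuous (absRpowDeriv p) := by
  have h : ContDiff ℝ 1 (fun t : ℝ => |t| ^ p) := contDiff_norm_rpow hp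
  have h2 := h.continuous_deriv le_rfl
  rwa [show deriv (fun t : ℝ => |t| ^ p) = absRpowDeriv p from
    funext fun t => (hasDerivAt_abs_rpow' hp t).deriv] at h2

theorem abs_absRpowDeriv {p : ℝ} (hp : 1 < p) (t : ℝ) :
    |absRpowDeriv p t| = p * |t| ^ (p - 1) := by
  rcases eq_or_ne t 0 with rfl | ht
  · simp [absRpowDeriv, Real.zero_rpow (by linarith : p - 1 ≠ 0)]
  · have : 0 < |t| := abs_pos.2 ht
    rw [absRpowDeriv, abs_mul, abs_mul, abs_of_pos (by linarith : 0 < p),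
      abs_of_nonneg (Real.rpow_nonneg this.le _), mul_assoc, ← Real.rpow_add_one this.ne']
    ring_nf

theorem absRpowDeriv_mul_self {p : ℝ} (hp : 1 < p) (t : ℝ) :
    absRpowDeriv p t * t = p * |t| ^ p := by
  rcases eq_or_ne t 0 with rfl | ht
  · simp [absRpowDeriv, Real.zero_rpow (by linarith : p ≠ 0)]
  · have : 0 < |t| := abs_pos.2 ht
    rw [absRpowDeriv, mul_assoc, ← abs_mul_abs_self t, mul_assoc, ← mul_assoc (|t| ^ (p - 2)),
      ← Real.rpow_add_one this.ne', ← Real.rpow_add_one this.ne']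
    ring_nf

theorem integral_absRpowDeriv {p : ℝ} (hp : 1 < p) (t : ℝ) :
    ∫ τ in (0 : ℝ)..t, absRpowDeriv p τ = |t| ^ p := by
  rw [intervalIntegral.integral_eq_sub_of_hasDerivAt (f := fun t : ℝ => |t| ^ p)
    (fun x _ => hasDerivAt_abs_rpow' hp x) ((continuous_absRpowDeriv hp).intervalIntegrable _ _)]
  simp [Real.zero_rpow (by linarith : p ≠ 0)]

theorem powerGrowth_absRpowDeriv {α : Type*} [MeasurableSpace α] (μ : Measure α) {p : ℝ}
    (hp : 1 < p) : PowerGrowth μ p fun _ => absRpowDeriv p where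
  aemeasurable _ := aemeasurable_const
  continuous := Eventually.of_forall fun _ => continuous_absRpowDeriv hp
  bound := ⟨fun _ => 0, p, by linarith, MemLp.zero (ε := ℝ),
    Eventually.of_forall fun _ t => by rw [abs_absRpowDeriv hp, zero_add]⟩

theorem integralFunctional_absRpowDeriv {α : Type*} [MeasurableSpace α] {μ : Measure α} {p : ℝ}
    [hp : Fact (1 < p)] (u : Lp ℝ (ENNReal.ofReal p) μ) :
    integralFunctional μ (fun _ => absRpowDeriv p) u = ‖u‖ ^ p := by
  rw [norm_Lp_rpow]
  simp only [integralFunctional, integral_absRpowDeriv hp.out]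

/-- `|t|^p` is strictly convex, so its derivative is strictly increasing. -/
theorem strictMono_absRpowDeriv {p : ℝ} (hp : 1 < p) : StrictMono (absRpowDeriv p) := by
  have hpos : ∀ a b : ℝ, 0 ≤ a → a < b → absRpowDeriv p a < absRpowDeriv p b := by
    have e : ∀ t : ℝ, 0 ≤ t → absRpowDeriv p t = p * t ^ (p - 1) := fun t ht => by
      have h1 : 0 ≤ absRpowDeriv p t := by unfold absRpowDeriv; positivity
      rw [← abs_of_nonneg h1, abs_absRpowDeriv hp, abs_of_nonneg ht]
    intro a b ha hab
    rw [e a ha, e b (ha.trans hab.le)]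
    exact mul_lt_mul_of_pos_left (Real.rpow_lt_rpow ha hab (by linarith)) (by linarith)
  have hneg : ∀ t : ℝ, absRpowDeriv p (-t) = -absRpowDeriv p t := fun t => by
    simp [absRpowDeriv]
  intro a b hab
  rcases le_or_gt 0 a with ha | ha
  · exact hpos a b ha hab
  rcases le_or_gt b 0 with hb | hb
  · have := hpos (-b) (-a) (by linarith) (by linarith)
    rw [hneg, hneg] at this
    linarith
  · have h1 := hpos 0 b le_rfl hb
    have h2 := hpos 0 (-a) le_rfl (by linarith)
    rw [hneg] at h2
    have h0 : absRpowDeriv p 0 = 0 := by simp [absRpowDeriv]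
    linarith

/-- A substitute, valid for all `p > 1`, for the usual inequalities between
`(|a|^{p-2}a - |b|^{p-2}b)(a - b)` and `|a - b|^p`. By homogeneity it suffices to consider
`max |a| |b| = 1`, where it follows from strict monotonicity and compactness. -/
theorem exists_abs_sub_rpow_le {p ε : ℝ} (hp : 1 < p) (hε : 0 < ε) :
    ∃ C : ℝ, 0 ≤ C ∧ ∀ a b : ℝ, |a - b| ^ p ≤
      C * ((absRpowDeriv p a - absRpowDeriv p b) * (a - b)) + ε * (|a| ^ p + |b| ^ p) := by
  have hp0 : 0 < p := by linarith
  have hmono : ∀ a b : ℝ, a ≠ b → 0 < (absRpowDeriv p a - absRpowDeriv p b) * (a - b) := by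
    intro a b hab
    rcases lt_or_gt_of_ne hab with h | h
    · exact mul_pos_of_neg_of_neg (sub_neg.2 (strictMono_absRpowDeriv hp h)) (sub_neg.2 h)
    · exact mul_pos (sub_pos.2 (strictMono_absRpowDeriv hp h)) (sub_pos.2 h)
  have hc := continuous_absRpowDeriv hp
  -- the part of the unit sphere where the second term alone does not suffice
  let K : Set (ℝ × ℝ) := Metric.sphere 0 1 ∩ {z | ε * (|z.1| ^ p + |z.2| ^ p) ≤ |z.1 - z.2| ^ p}
  have hK : IsCompact K := by
    refine (isCompact_sphere _ _).inter_right (isClosed_le ?_ ?_)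
    · exact continuous_const.mul ((continuous_fst.abs.rpow_const fun _ => Or.inr hp0.le).add
        (continuous_snd.abs.rpow_const fun _ => Or.inr hp0.le))
    · exact (continuous_fst.sub continuous_snd).abs.rpow_const fun _ => Or.inr hp0.le
  let m : ℝ × ℝ → ℝ := fun z => (absRpowDeriv p z.1 - absRpowDeriv p z.2) * (z.1 - z.2)
  have hm : Continuous m :=
    ((hc.comp continuous_fst).sub (hc.comp continuous_snd)).mul (continuous_fst.sub continuous_snd)
  have hnorm : ∀ a b : ℝ, ‖(a, b)‖ = 1 → 0 < |a| ^ p + |b| ^ p := by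
    intro a b h
    rw [Prod.norm_mk] at h
    rcases max_choice ‖a‖ ‖b‖ with h' | h' <;> rw [h', Real.norm_eq_abs] at h
    · have : |a| ^ p = 1 := by rw [h, Real.one_rpow]
      linarith [Real.rpow_nonneg (abs_nonneg b) p]
    · have : |b| ^ p = 1 := by rw [h, Real.one_rpow]
      linarith [Real.rpow_nonneg (abs_nonneg a) p]
  obtain ⟨d, hd, hdK⟩ : ∃ d > 0, ∀ z ∈ K, d ≤ m z := by
    rcases K.eq_empty_or_nonempty with h | h
    · exact ⟨1, one_pos, by simp [h]⟩
    · obtain ⟨z, hz, hmin⟩ := hK.exists_isMinOn h hm.continuousOn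
      refine ⟨m z, hmono _ _ fun hzz => ?_, fun w hw => hmin hw⟩
      have h2 := hz.2
      simp only [mem_ofPred_eq] at h2
      rw [hzz, sub_self, abs_zero, Real.zero_rpow hp0.ne', ← hzz] at h2
      have h3 := mem_sphere_zero_iff_norm.1 hz.1
      rw [← Prod.mk.eta (p := z), ← hzz] at h3
      have := hnorm z.1 z.1 h3
      nlinarith
  have hm0 : ∀ z, 0 ≤ m z := fun z => by
    by_cases h : z.1 = z.2
    · simp [m, h]
    · exact (hmono _ _ h).le
  have hsphere : ∀ a b : ℝ, ‖(a, b)‖ = 1 → |a - b| ^ p ≤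
      2 ^ p / d * m (a, b) + ε * (|a| ^ p + |b| ^ p) := by
    intro a b h
    by_cases hab : ε * (|a| ^ p + |b| ^ p) ≤ |a - b| ^ p
    · have h1 := hdK (a, b) ⟨mem_sphere_zero_iff_norm.2 h, hab⟩
      have h2 : |a - b| ^ p ≤ 2 ^ p := by
        refine Real.rpow_le_rpow (abs_nonneg _) ?_ hp0.le
        have ha : |a| ≤ 1 := h ▸ norm_fst_le (a, b)
        have hb : |b| ≤ 1 := h ▸ norm_snd_le (a, b)
        exact (abs_sub a b).trans (by linarith)
      have h3 : 2 ^ p ≤ 2 ^ p / d * m (a, b) := by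
        rw [div_mul_eq_mul_div, le_div_iff₀ hd]
        exact mul_le_mul_of_nonneg_left h1 (by positivity)
      have h4 := hnorm a b h
      nlinarith
    · have := hm0 (a, b)
      have : 0 ≤ 2 ^ p / d * m (a, b) := by positivity
      linarith
  refine ⟨2 ^ p / d, by positivity, fun a b => ?_⟩
  set r : ℝ := ‖(a, b)‖ with hr
  rcases (norm_nonneg (a, b)).eq_or_lt with h0 | h0
  · have : (a, b) = 0 := norm_eq_zero.1 h0.symm
    obtain ⟨rfl, rfl⟩ : a = 0 ∧ b = 0 := Prod.mk_eq_zero.1 this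
    simp [Real.zero_rpow hp0.ne']
  rw [← hr] at h0
  have h1 := hsphere (a / r) (b / r) (by
    have : (a / r, b / r) = r⁻¹ • (a, b) := by simp [div_eq_inv_mul]
    rw [this, norm_smul, norm_inv, Real.norm_eq_abs, abs_of_pos h0, hr, inv_mul_cancel₀]
    rw [← hr]; exact h0.ne')
  have hdiv : ∀ t : ℝ, |t / r| ^ p = |t| ^ p / r ^ p := fun t => by
    rw [abs_div, abs_of_pos h0, Real.div_rpow (abs_nonneg _) h0.le]
  have hhom : ∀ t : ℝ, absRpowDeriv p (t / r) = absRpowDeriv p t / (r ^ p / r) := fun t => by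
    have : r ^ p = r ^ (p - 2) * r * r := by
      rw [mul_assoc, ← pow_two, ← Real.rpow_natCast r 2, ← Real.rpow_add h0]
      norm_num
    have hr2 : 0 < r ^ (p - 2) := Real.rpow_pos_of_pos h0 _
    rw [absRpowDeriv, absRpowDeriv, abs_div, abs_of_pos h0, Real.div_rpow (abs_nonneg _) h0.le,
      this]
    field_simp
  have hrp : 0 < r ^ p := Real.rpow_pos_of_pos h0 _
  have hmr : m (a / r, b / r) = m (a, b) / r ^ p := by
    simp only [m, hhom]
    field_simp
  rw [← sub_div, hdiv, hdiv, hdiv, hmr] at h1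
  have h2 := mul_le_mul_of_nonneg_right h1 hrp.le
  rw [div_mul_cancel₀ _ hrp.ne'] at h2
  refine h2.trans (le_of_eq ?_)
  simp only [m]
  field_simp

end SignedPower

/-! ### The space `X` -/

section Space

variable {N : ℕ} {Ω : BoundedLipschitzDomain N} {s p : ℝ}

theorem measurableSet_carrier (Ω : BoundedLipschitzDomain N) : MeasurableSet Ω.carrier :=
  Ω.isOpen.measurableSet

theorem measurableSet_crossSet (Ω : BoundedLipschitzDomain N) : MeasurableSet (crossSet Ω) :=
  ((measurableSet_carrier Ω).compl.prod (measurableSet_carrier Ω).compl).compl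

/-- If the functions converge almost everywhere in `Ω` and the difference quotients almost
everywhere in `𝒬`, then the functions converge almost everywhere in `ℝ^N`: fix a good point
`x ∈ Ω` and recover `u(y)` from `u(x)` and the quotient at `(x, y)`. -/
theorem ae_exists_tendsto {u : ℕ → EuclideanSpace ℝ (Fin N) → ℝ}
    {h : EuclideanSpace ℝ (Fin N) × EuclideanSpace ℝ (Fin N) → ℝ}
    {w : EuclideanSpace ℝ (Fin N) → ℝ}
    (hD : ∀ᵐ z ∂volume.restrict (crossSet Ω),
      Tendsto (fun n => diffQuot s p (u n) z) atTop (𝓝 (h z)))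
    (hR : ∀ᵐ x ∂volume.restrict Ω.carrier, Tendsto (fun n => u n x) atTop (𝓝 (w x))) :
    ∀ᵐ y, ∃ l, Tendsto (fun n => u n y) atTop (𝓝 l) := by
  rw [ae_restrict_iff' (measurableSet_crossSet Ω)] at hD
  rw [ae_restrict_iff' (measurableSet_carrier Ω)] at hR
  have hD' := Measure.ae_ae_of_ae_prod (μ := volume) (ν := volume) hD
  have hpos : volume Ω.carrier ≠ 0 := (Ω.isOpen.measure_pos _ Ω.isConnected.nonempty).ne'
  obtain ⟨x, hx, hxw, hy⟩ : ∃ x ∈ Ω.carrier, Tendsto (fun n => u n x) atTop (𝓝 (w x)) ∧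
      ∀ᵐ y, (x, y) ∈ crossSet Ω →
        Tendsto (fun n => diffQuot s p (u n) (x, y)) atTop (𝓝 (h (x, y))) := by
    by_contra hcon
    refine hpos (measure_mono_null ?_ (hR.and hD'))
    exact fun x hx hx' => hcon ⟨x, hx, hx'.1 hx, hx'.2⟩
  filter_upwards [hy] with y hy
  by_cases hxy : x = y
  · exact ⟨w x, hxy ▸ hxw⟩
  set k : ℝ := ‖x - y‖ ^ (((N : ℝ) + p * s) / p) with hk
  have hk0 : k ≠ 0 := (Real.rpow_pos_of_pos (norm_pos_iff.2 (sub_ne_zero.2 hxy)) _).ne'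
  refine ⟨w x - h (x, y) * k, ?_⟩
  refine (hxw.sub ((hy (by simp [crossSet, hx])).mul_const k)).congr fun n => ?_
  simp only [diffQuot, ← hk]
  rw [div_mul_cancel₀ _ hk0]
  ring

variable [hp : Fact (1 < p)]

variable (Ω s p) in
/-- The difference quotient as a bounded operator from `X` to `L^p(𝒬)`. -/
noncomputable def diffQuotL :
    XSpace Ω s p →L[ℝ] Lp ℝ (ENNReal.ofReal p) (volume.restrict (crossSet Ω)) :=
  LinearMap.mkContinuous
    { toFun := fun u => u.memLp.1.toLp _
      map_add' := fun u v => by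
        rw [← MemLp.toLp_add]
        exact MemLp.toLp_congr _ _ (ae_restrict_of_ae (diffQuot_add s p u.1 v.1))
      map_smul' := fun c u => by
        rw [RingHom.id_apply, ← MemLp.toLp_const_smul]
        exact MemLp.toLp_congr _ _ (ae_restrict_of_ae (diffQuot_smul s p c u.1)) } 1
    fun u => by
      have h1 := hp.out
      rw [one_mul, XSpace.norm_eq, LinearMap.coe_mk, AddHom.coe_mk, Lp.norm_toLp]
      refine le_trans (le_of_eq ?_) (Real.rpow_le_rpow (by positivity)
        (le_add_of_nonneg_right (by positivity)) (by positivity))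
      rw [← Real.rpow_mul ENNReal.toReal_nonneg, mul_one_div_cancel (by linarith), Real.rpow_one]

variable (Ω s p) in
/-- The restriction to `Ω` as a bounded operator from `X` to `L^p(Ω)`. -/
noncomputable def restrictL :
    XSpace Ω s p →L[ℝ] Lp ℝ (ENNReal.ofReal p) (volume.restrict Ω.carrier) :=
  LinearMap.mkContinuous
    { toFun := fun u => u.memLp.2.toLp _
      map_add' := fun u v => by
        rw [← MemLp.toLp_add]
        exact MemLp.toLp_congr _ _ (ae_restrict_of_ae (AEEqFun.coeFn_add u.1 v.1))
      map_smul' := fun c u => by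
        rw [RingHom.id_apply, ← MemLp.toLp_const_smul]
        exact MemLp.toLp_congr _ _ (ae_restrict_of_ae (AEEqFun.coeFn_smul c u.1)) } 1
    fun u => by
      have h1 := hp.out
      rw [one_mul, XSpace.norm_eq, LinearMap.coe_mk, AddHom.coe_mk, Lp.norm_toLp]
      refine le_trans (le_of_eq ?_) (Real.rpow_le_rpow (by positivity)
        (le_add_of_nonneg_left (by positivity)) (by positivity))
      rw [← Real.rpow_mul ENNReal.toReal_nonneg, mul_one_div_cancel (by linarith), Real.rpow_one]

theorem coeFn_diffQuotL (u : XSpace Ω s p) :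
    diffQuotL Ω s p u =ᵐ[volume.restrict (crossSet Ω)] diffQuot s p u :=
  u.memLp.1.coeFn_toLp

theorem coeFn_restrictL (u : XSpace Ω s p) :
    restrictL Ω s p u =ᵐ[volume.restrict Ω.carrier] u :=
  u.memLp.2.coeFn_toLp

theorem gagliardoEnergy_eq (u : XSpace Ω s p) :
    gagliardoEnergy Ω s p u = ‖diffQuotL Ω s p u‖ ^ p := by
  rw [norm_Lp_rpow, gagliardoEnergy]
  refine integral_congr_ae ?_
  filter_upwards [coeFn_diffQuotL u] with z hz
  rw [hz, ← norm_diffQuot_rpow s hp.out, Real.norm_eq_abs]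

theorem powIntegral_eq (u : XSpace Ω s p) :
    powIntegral Ω p u = ‖restrictL Ω s p u‖ ^ p := by
  rw [norm_Lp_rpow, powIntegral]
  refine integral_congr_ae ?_
  filter_upwards [coeFn_restrictL u] with z hz
  rw [hz]

theorem norm_rpow_eq (u : XSpace Ω s p) :
    ‖u‖ ^ p = ‖diffQuotL Ω s p u‖ ^ p + ‖restrictL Ω s p u‖ ^ p := by
  have h1 := hp.out
  rw [XSpace.norm_def, gagliardoEnergy_eq, powIntegral_eq, ← Real.rpow_mul (by positivity),
    one_div_mul_cancel (by linarith), Real.rpow_one]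

theorem norm_le_add (u : XSpace Ω s p) :
    ‖u‖ ≤ ‖diffQuotL Ω s p u‖ + ‖restrictL Ω s p u‖ := by
  rw [XSpace.norm_def, gagliardoEnergy_eq, powIntegral_eq]
  exact Real.rpow_add_rpow_le_add (norm_nonneg _) (norm_nonneg _) hp.out.le

theorem tendsto_of_diffQuotL_restrictL {ι : Type*} {l : Filter ι} {u : ι → XSpace Ω s p}
    {v : XSpace Ω s p} (hD : Tendsto (fun n => diffQuotL Ω s p (u n)) l (𝓝 (diffQuotL Ω s p v)))
    (hR : Tendsto (fun n => restrictL Ω s p (u n)) l (𝓝 (restrictL Ω s p v))) :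
    Tendsto u l (𝓝 v) := by
  rw [tendsto_iff_norm_sub_tendsto_zero] at hD hR ⊢
  refine squeeze_zero (fun n => norm_nonneg _) (fun n => norm_le_add _) ?_
  simp only [map_sub]
  simpa using hD.add hR

instance completeSpace_XSpace : CompleteSpace (XSpace Ω s p) := by
  refine Metric.complete_of_cauchySeq_tendsto fun u hu => ?_
  obtain ⟨h, hh⟩ := cauchySeq_tendsto_of_complete
    ((diffQuotL Ω s p).uniformContinuous.comp_cauchySeq hu)
  obtain ⟨w, hw⟩ := cauchySeq_tendsto_of_complete
    ((restrictL Ω s p).uniformContinuous.comp_cauchySeq hu)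
  obtain ⟨φ, hφ, hφD⟩ := (tendstoInMeasure_of_tendsto_Lp hh).exists_seq_tendsto_ae
  obtain ⟨ψ, hψ, hψR⟩ := (tendstoInMeasure_of_tendsto_Lp
    (hw.comp hφ.tendsto_atTop)).exists_seq_tendsto_ae
  have hD : ∀ᵐ z ∂volume.restrict (crossSet Ω),
      Tendsto (fun n => diffQuot s p (u (φ (ψ n))) z) atTop (𝓝 (h z)) := by
    filter_upwards [hφD, ae_all_iff.2 fun n => coeFn_diffQuotL (u n)] with z hz hz'
    exact (hz.comp hψ.tendsto_atTop).congr fun n => hz' _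
  have hR : ∀ᵐ x ∂volume.restrict Ω.carrier,
      Tendsto (fun n => u (φ (ψ n)) x) atTop (𝓝 (w x)) := by
    filter_upwards [hψR, ae_all_iff.2 fun n => coeFn_restrictL (u n)] with z hz hz'
    exact hz.congr fun n => hz' _
  obtain ⟨v, hvm, hv⟩ := exists_stronglyMeasurable_limit_of_tendsto_ae
    (fun n => (u (φ (ψ n))).1.aestronglyMeasurable) (ae_exists_tendsto hD hR)
  set V : EuclideanSpace ℝ (Fin N) →ₘ[volume] ℝ := AEEqFun.mk v hvm.aestronglyMeasurable with hV
  have hVv : V =ᵐ[volume] v := AEEqFun.coeFn_mk _ _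
  have hv' : ∀ᵐ x, Tendsto (fun n => u (φ (ψ n)) x) atTop (𝓝 (V x)) := by
    filter_upwards [hv, hVv] with x hx hx'
    rwa [hx']
  have hVR : V =ᵐ[volume.restrict Ω.carrier] w := by
    filter_upwards [hR, ae_restrict_of_ae hv'] with x h1 h2
    exact tendsto_nhds_unique h2 h1
  have hVD : diffQuot s p V =ᵐ[volume.restrict (crossSet Ω)] h := by
    have h1 := Measure.quasiMeasurePreserving_fst
      (μ := (volume : Measure (EuclideanSpace ℝ (Fin N))))
      (ν := (volume : Measure (EuclideanSpace ℝ (Fin N)))) |>.ae hv'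
    have h2 := Measure.quasiMeasurePreserving_snd
      (μ := (volume : Measure (EuclideanSpace ℝ (Fin N))))
      (ν := (volume : Measure (EuclideanSpace ℝ (Fin N)))) |>.ae hv'
    filter_upwards [hD, ae_restrict_of_ae h1, ae_restrict_of_ae h2] with z hz hz1 hz2
    exact tendsto_nhds_unique ((hz1.sub hz2).div_const _) hz
  let v' : XSpace Ω s p := ⟨V, (finiteEnergy_iff Ω s hp.out V).2
    ⟨(memLp_congr_ae hVD).2 (Lp.memLp h), (memLp_congr_ae hVR).2 (Lp.memLp w)⟩⟩
  refine ⟨v', tendsto_of_diffQuotL_restrictL ?_ ?_⟩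
  · rwa [show diffQuotL Ω s p v' = h from Lp.ext ((coeFn_diffQuotL v').trans hVD)]
  · rwa [show restrictL Ω s p v' = w from Lp.ext ((coeFn_restrictL v').trans hVR)]

end Space

/-! ### Measure density of Lipschitz domains -/

section MeasureDensity

variable {N : ℕ}

/-- A bounded Lipschitz domain contains, inside each small ball centred at one of its points, a
ball of comparable radius: move a distance `r / 2` along the axis of the local graph. -/
theorem exists_interior_ball (Ω : BoundedLipschitzDomain N) :
    ∃ κ > 0, ∃ ρ > 0, ∀ x ∈ Ω.carrier, ∀ r, 0 < r → r < ρ →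
      ∃ z, Metric.ball z (κ * r) ⊆ Ω.carrier ∩ Metric.ball x r := by
  have hcpt : IsCompact (closure Ω.carrier) := Ω.isBounded.isCompact_closure
  suffices h : ∃ κ > 0, ∃ ρ > 0, ∀ x ∈ Ω.carrier ∩ closure Ω.carrier, ∀ r, 0 < r → r < ρ →
      ∃ z, Metric.ball z (κ * r) ⊆ Ω.carrier ∩ Metric.ball x r by
    obtain ⟨κ, hκ, ρ, hρ, h⟩ := h
    exact ⟨κ, hκ, ρ, hρ, fun x hx => h x ⟨hx, subset_closure hx⟩⟩
  refine hcpt.induction_on (p := fun S => ∃ κ > 0, ∃ ρ > 0, ∀ x ∈ Ω.carrier ∩ S, ∀ r, 0 < r →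
      r < ρ → ∃ z, Metric.ball z (κ * r) ⊆ Ω.carrier ∩ Metric.ball x r) ?_ ?_ ?_ ?_
  · exact ⟨1, one_pos, 1, one_pos, by simp⟩
  · rintro S S' hS ⟨κ, hκ, ρ, hρ, h⟩
    exact ⟨κ, hκ, ρ, hρ, fun x hx => h x ⟨hx.1, hS hx.2⟩⟩
  · rintro S S' ⟨κ, hκ, ρ, hρ, h⟩ ⟨κ', hκ', ρ', hρ', h'⟩
    refine ⟨min κ κ', lt_min hκ hκ', min ρ ρ', lt_min hρ hρ', ?_⟩
    rintro x ⟨hx, hxS | hxS⟩ r hr hrρ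
    · obtain ⟨z, hz⟩ := h x ⟨hx, hxS⟩ r hr (hrρ.trans_le (min_le_left _ _))
      exact ⟨z, (Metric.ball_subset_ball (by gcongr; exact min_le_left _ _)).trans hz⟩
    · obtain ⟨z, hz⟩ := h' x ⟨hx, hxS⟩ r hr (hrρ.trans_le (min_le_right _ _))
      exact ⟨z, (Metric.ball_subset_ball (by gcongr; exact min_le_right _ _)).trans hz⟩
  · intro x₀ hx₀
    by_cases hmem : x₀ ∈ Ω.carrier
    · obtain ⟨ε, hε, hball⟩ := Metric.isOpen_iff.1 Ω.isOpen x₀ hmem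
      refine ⟨Metric.ball x₀ (ε / 2), mem_nhdsWithin_of_mem_nhds
        (Metric.ball_mem_nhds _ (by linarith)), 1, one_pos, ε / 2, by linarith, ?_⟩
      rintro x ⟨-, hx⟩ r hr hrε
      refine ⟨x, fun y hy => ?_⟩
      rw [one_mul] at hy
      refine ⟨hball ?_, hy⟩
      rw [Metric.mem_ball] at hx hy ⊢
      linarith [dist_triangle y x x₀]
    · have hfr : x₀ ∈ frontier Ω.carrier := by
        rw [frontier, Ω.isOpen.interior_eq]; exact ⟨hx₀, hmem⟩
      obtain ⟨R, e, K, γ, hR, he, hγ, hgraph⟩ := Ω.lipschitz_boundary x₀ hfr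
      have hK : (0 : ℝ) ≤ K := K.coe_nonneg
      -- small enough for `r / 2` to exceed `κ r`, the loss in the direction of `e`, plus `2 K κ r`,
      -- the variation of `γ`
      set κ : ℝ := 1 / (4 * (K + 1)) with hκ
      have hκ0 : 0 < κ := by positivity
      have hκK : κ * (1 + 2 * K) < 1 / 2 := by
        rw [hκ, one_div_mul_eq_div, div_lt_div_iff₀ (by positivity) (by norm_num)]
        linarith
      refine ⟨Metric.ball x₀ (R / 2), mem_nhdsWithin_of_mem_nhds
        (Metric.ball_mem_nhds _ (by linarith)), κ, hκ0, R / 2, by linarith, ?_⟩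
      rintro x ⟨hxΩ, hx⟩ r hr hrR
      refine ⟨x + (r / 2) • e, fun y hy => ?_⟩
      obtain ⟨w, rfl⟩ : ∃ w, y = x + (r / 2) • e + w := ⟨y - (x + (r / 2) • e), by abel⟩
      have hw : ‖w‖ < κ * r := by
        rwa [Metric.mem_ball, dist_eq_norm, add_sub_cancel_left] at hy
      have hee : inner ℝ e e = (1 : ℝ) := by rw [real_inner_self_eq_norm_sq, he]; norm_num
      have hew : |inner ℝ e w| ≤ ‖w‖ := by
        have := abs_real_inner_le_norm e w
        rwa [he, one_mul] at this
      have hyx : dist (x + (r / 2) • e + w) x < r := by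
        rw [dist_eq_norm, show x + (r / 2) • e + w - x = (r / 2) • e + w by abel]
        refine (norm_add_le _ _).trans_lt ?_
        rw [norm_smul, he, mul_one, Real.norm_eq_abs, abs_of_pos (by linarith)]
        nlinarith
      have hxx : x ∈ Metric.ball x₀ R := Metric.ball_subset_ball (by linarith) hx
      have hyR : x + (r / 2) • e + w ∈ Metric.ball x₀ R := by
        rw [Metric.mem_ball] at hx ⊢
        linarith [dist_triangle (x + (r / 2) • e + w) x x₀]
      refine ⟨(hgraph _ hyR).2 ?_, hyx⟩
      have h1 := (hgraph x hxx).1 hxΩ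
      have hin : inner ℝ e (x + (r / 2) • e + w) = inner ℝ e x + r / 2 + inner ℝ e w := by
        rw [inner_add_right, inner_add_right, inner_smul_right, hee, mul_one]
      have h2 := hγ.dist_le_mul
        (x + (r / 2) • e + w - inner ℝ e (x + (r / 2) • e + w) • e) (x - inner ℝ e x • e)
      rw [dist_eq_norm, dist_eq_norm, show x + (r / 2) • e + w -
          inner ℝ e (x + (r / 2) • e + w) • e - (x - inner ℝ e x • e) = w - inner ℝ e w • e by
        rw [hin, add_smul, add_smul]; abel] at h2
      have h3 : ‖w - inner ℝ e w • e‖ ≤ 2 * ‖w‖ := by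
        refine (norm_sub_le _ _).trans ?_
        rw [norm_smul, he, mul_one, Real.norm_eq_abs]
        linarith
      have h4 := (le_abs_self _).trans h2
      rw [hin] at h4 ⊢
      have h5 : K * ‖w - inner ℝ e w • e‖ ≤ K * (2 * (κ * r)) :=
        mul_le_mul_of_nonneg_left (h3.trans (by linarith)) hK
      have h6 := (abs_le.1 hew).1
      nlinarith

/-- The measure density condition: `|Ω ∩ B(x,r)| ≥ c r^N` for `x ∈ Ω` and small `r`. -/
theorem exists_measure_density (Ω : BoundedLipschitzDomain N) :
    ∃ c > 0, ∃ ρ > 0, ∀ x ∈ Ω.carrier, ∀ r, 0 < r → r < ρ →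
      ENNReal.ofReal (c * r ^ N) ≤ volume (Ω.carrier ∩ Metric.ball x r) := by
  obtain ⟨κ, hκ, ρ, hρ, h⟩ := exists_interior_ball Ω
  set ω := volume (Metric.ball (0 : EuclideanSpace ℝ (Fin N)) 1) with hω
  have hω0 : 0 < ω := Metric.measure_ball_pos _ _ one_pos
  have hωt : ω ≠ ∞ := measure_ball_lt_top.ne
  refine ⟨κ ^ N * ω.toReal, mul_pos (by positivity) (ENNReal.toReal_pos hω0.ne' hωt), ρ, hρ,
    fun x hx r hr hrρ => ?_⟩
  obtain ⟨z, hz⟩ := h x hx r hr hrρ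
  refine le_trans (le_of_eq ?_) (measure_mono hz)
  rw [Measure.addHaar_ball_of_pos _ _ (by positivity), finrank_euclideanSpace, Fintype.card_fin,
    ← hω, mul_right_comm, ← mul_pow, ENNReal.ofReal_mul (by positivity), ENNReal.ofReal_toReal hωt]

/-- Points of a bounded domain can be approximated, uniformly and measurably, by finitely many of
its points. -/
theorem exists_simpleFunc_dist_lt (Ω : BoundedLipschitzDomain N) {r : ℝ} (hr : 0 < r) :
    ∃ π : SimpleFunc (EuclideanSpace ℝ (Fin N)) (EuclideanSpace ℝ (Fin N)),
      (∀ x, π x ∈ Ω.carrier) ∧ ∀ x ∈ Ω.carrier, dist x (π x) < r := by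
  have htb : TotallyBounded Ω.carrier :=
    Ω.isBounded.isCompact_closure.totallyBounded.subset subset_closure
  obtain ⟨t, htΩ, htf, hcov⟩ := Metric.finite_approx_of_totallyBounded htb r hr
  obtain ⟨x₀, hx₀⟩ := Ω.isConnected.nonempty
  have hne : t.Nonempty := by
    obtain ⟨c, hc, -⟩ := mem_iUnion₂.1 (hcov hx₀)
    exact ⟨c, hc⟩
  obtain ⟨e, he⟩ := htf.countable.exists_eq_range hne
  have hidx : ∃ M : ℕ, ∀ c ∈ t, ∃ k ≤ M, e k = c := by
    choose! k hk using fun c (hc : c ∈ t) => (he ▸ hc : c ∈ range e)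
    obtain ⟨M, hM⟩ := (htf.image k).bddAbove
    exact ⟨M, fun c hc => ⟨k c, hM ⟨c, hc, rfl⟩, hk c hc⟩⟩
  obtain ⟨M, hM⟩ := hidx
  refine ⟨SimpleFunc.nearestPt e M, fun x => htΩ ?_, fun x hx => ?_⟩
  · rw [he, SimpleFunc.nearestPt, SimpleFunc.coe_map]
    exact mem_range_self _
  · obtain ⟨c, hc, hxc⟩ := mem_iUnion₂.1 (hcov hx)
    obtain ⟨k, hk, rfl⟩ := hM c hc
    have h1 := SimpleFunc.edist_nearestPt_le e x hk
    rw [edist_dist, edist_dist, ENNReal.ofReal_le_ofReal_iff dist_nonneg] at h1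
    rw [dist_comm]
    rw [Metric.mem_ball, dist_comm] at hxc
    exact h1.trans_lt hxc

end MeasureDensity

/-! ### Local averages -/

section Averages

theorem rpow_lintegral_le {α : Type*} [MeasurableSpace α] {ν : Measure α} [IsProbabilityMeasure ν]
    {p : ℝ} (hp : 1 < p) {f : α → ℝ} (hf : AEStronglyMeasurable f ν) :
    (∫⁻ x, ‖f x‖ₑ ∂ν) ^ p ≤ ∫⁻ x, ‖f x‖ₑ ^ p ∂ν := by
  have h := eLpNorm'_le_eLpNorm'_of_exponent_le (μ := ν) one_pos hp.le hf
  simp only [eLpNorm', ENNReal.rpow_one, div_one] at h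
  have h2 := ENNReal.rpow_le_rpow h (by linarith : 0 ≤ p)
  rwa [← ENNReal.rpow_mul, one_div_mul_cancel (by linarith), ENNReal.rpow_one] at h2

/-- Jensen's inequality for the deviation from the mean. -/
theorem enorm_sub_average_rpow_le {α : Type*} [MeasurableSpace α] {μ : Measure α} {A : Set α}
    (h0 : μ A ≠ 0) (ht : μ A ≠ ∞) {p : ℝ} (hp : 1 < p) {u : α → ℝ} (hu : IntegrableOn u A μ)
    (t : ℝ) :
    ‖t - ⨍ y in A, u y ∂μ‖ₑ ^ p ≤ (μ A)⁻¹ * ∫⁻ y in A, ‖t - u y‖ₑ ^ p ∂μ := by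
  have : IsFiniteMeasure (μ.restrict A) := ⟨by simpa using ht.lt_top⟩
  have : NeZero (μ.restrict A) := ⟨by simpa using h0⟩
  set ν : Measure α := ((μ.restrict A) univ)⁻¹ • μ.restrict A with hν
  have hνu : Integrable u ν := hu.smul_measure (by simpa using h0)
  have hreal : μ.real A ≠ 0 := ENNReal.toReal_ne_zero.2 ⟨h0, ht⟩
  have e : t - ⨍ y in A, u y ∂μ = ∫ y, (t - u y) ∂ν := by
    rw [integral_sub (integrable_const _) hνu]
    simp only [hν, integral_const, measureReal_ennreal_smul_apply, average]
    simp [← measureReal_def, hreal]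
  rw [e]
  calc ‖∫ y, (t - u y) ∂ν‖ₑ ^ p ≤ (∫⁻ y, ‖t - u y‖ₑ ∂ν) ^ p :=
        ENNReal.rpow_le_rpow (enorm_integral_le_lintegral_enorm _) (by linarith)
    _ ≤ ∫⁻ y, ‖t - u y‖ₑ ^ p ∂ν := rpow_lintegral_le hp ((integrable_const t).sub hνu).1
    _ = _ := by rw [hν, lintegral_smul_measure, Measure.restrict_apply_univ, smul_eq_mul]

theorem enorm_average_sub_average_rpow_le {α : Type*} [MeasurableSpace α] {μ : Measure α}
    {A B : Set α} (hA0 : μ A ≠ 0) (hAt : μ A ≠ ∞) (hB0 : μ B ≠ 0) (hBt : μ B ≠ ∞) {p : ℝ}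
    (hp : 1 < p) {u : α → ℝ} (huA : IntegrableOn u A μ) (huB : IntegrableOn u B μ) :
    ‖(⨍ y in A, u y ∂μ) - ⨍ z in B, u z ∂μ‖ₑ ^ p ≤
      (μ A)⁻¹ * ((μ B)⁻¹ * ∫⁻ y in A, ∫⁻ z in B, ‖u y - u z‖ₑ ^ p ∂μ ∂μ) := by
  rw [enorm_sub_rev]
  refine (enorm_sub_average_rpow_le hA0 hAt hp huA _).trans ?_
  rw [← lintegral_const_mul' _ _ (ENNReal.inv_ne_top.2 hB0)]
  refine mul_le_mul_right (lintegral_mono fun y => ?_) _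
  rw [enorm_sub_rev]
  exact enorm_sub_average_rpow_le hB0 hBt hp huB _

variable {N : ℕ} {s p : ℝ}

theorem enorm_sub_rpow_le_diffQuot (hs : 0 < s) (hp : 1 < p) (u : EuclideanSpace ℝ (Fin N) → ℝ)
    {y z : EuclideanSpace ℝ (Fin N)} {r : ℝ} (h : dist y z ≤ r) :
    ‖u y - u z‖ₑ ^ p ≤ ENNReal.ofReal (r ^ ((N : ℝ) + p * s)) * ‖diffQuot s p u (y, z)‖ₑ ^ p := by
  have hp0 : 0 < p := by linarith
  have hps : 0 < p * s := by positivity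
  have hr : 0 ≤ r := dist_nonneg.trans h
  by_cases hyz : y = z
  · simp [hyz, ENNReal.zero_rpow_of_pos hp0]
  have hd : 0 < ‖y - z‖ := norm_pos_iff.2 (sub_ne_zero.2 hyz)
  rw [← ofReal_norm, ← ofReal_norm,
    ENNReal.ofReal_rpow_of_nonneg (norm_nonneg _) hp0.le,
    ENNReal.ofReal_rpow_of_nonneg (norm_nonneg _) hp0.le, norm_diffQuot_rpow s hp,
    ← ENNReal.ofReal_mul (by positivity)]
  refine ENNReal.ofReal_le_ofReal ?_
  rw [gagliardoIntegrand, Real.norm_eq_abs, mul_div_assoc', le_div_iff₀ (by positivity), mul_comm]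
  refine mul_le_mul_of_nonneg_right (Real.rpow_le_rpow hd.le ?_ (by positivity)) (by positivity)
  rwa [← dist_eq_norm]

theorem measurable_diffQuot {u : EuclideanSpace ℝ (Fin N) → ℝ} (hu : Measurable u) :
    Measurable (diffQuot s p u) := by
  unfold diffQuot
  fun_prop

variable (Ω : BoundedLipschitzDomain N)

/-- The Gagliardo energy over `Ω × Ω`, as an extended nonnegative number. -/
noncomputable def innerEnergy (s p : ℝ) (u : EuclideanSpace ℝ (Fin N) → ℝ) : ℝ≥0∞ :=
  ∫⁻ y in Ω.carrier, ∫⁻ z in Ω.carrier, ‖diffQuot s p u (y, z)‖ₑ ^ p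

variable {Ω} {c ρ : ℝ}

theorem volume_inter_ball_ne_top (x : EuclideanSpace ℝ (Fin N)) (r : ℝ) :
    volume (Ω.carrier ∩ Metric.ball x r) ≠ ∞ :=
  ((measure_mono inter_subset_right).trans_lt measure_ball_lt_top).ne

theorem volume_inter_ball_ne_zero {x : EuclideanSpace ℝ (Fin N)} (hx : x ∈ Ω.carrier) {r : ℝ}
    (hr : 0 < r) : volume (Ω.carrier ∩ Metric.ball x r) ≠ 0 :=
  ((Ω.isOpen.inter Metric.isOpen_ball).measure_pos _ ⟨x, hx, Metric.mem_ball_self hr⟩).ne'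

/-- The local averages approximate `u` in `L^p(Ω)`. -/
theorem lintegral_enorm_sub_average_le (hs : 0 < s) (hp : 1 < p) (hc : 0 < c)
    (hdens : ∀ x ∈ Ω.carrier, ∀ r, 0 < r → r < ρ →
      ENNReal.ofReal (c * r ^ N) ≤ volume (Ω.carrier ∩ Metric.ball x r))
    {u : EuclideanSpace ℝ (Fin N) → ℝ} (hu : IntegrableOn u Ω.carrier)
    {π : EuclideanSpace ℝ (Fin N) → EuclideanSpace ℝ (Fin N)} {r : ℝ} (hr : 0 < r) (hrρ : r < ρ)
    (hπ : ∀ x, π x ∈ Ω.carrier) (hπr : ∀ x ∈ Ω.carrier, dist x (π x) < r) :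
    ∫⁻ x in Ω.carrier, ‖u x - ⨍ y in Ω.carrier ∩ Metric.ball (π x) r, u y‖ₑ ^ p ≤
      ENNReal.ofReal (c⁻¹ * 2 ^ ((N : ℝ) + p * s) * r ^ (p * s)) * innerEnergy Ω s p u := by
  rw [innerEnergy, ← lintegral_const_mul' _ _ ENNReal.ofReal_ne_top]
  refine lintegral_mono_ae ?_
  filter_upwards [ae_restrict_mem (measurableSet_carrier Ω)] with x hx
  refine (enorm_sub_average_rpow_le (volume_inter_ball_ne_zero (hπ x) hr)
    (volume_inter_ball_ne_top _ _) hp (hu.mono_set inter_subset_left) _).trans ?_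
  have h1 : ∫⁻ y in Ω.carrier ∩ Metric.ball (π x) r, ‖u x - u y‖ₑ ^ p ≤
      ENNReal.ofReal ((2 * r) ^ ((N : ℝ) + p * s)) *
        ∫⁻ y in Ω.carrier, ‖diffQuot s p u (x, y)‖ₑ ^ p := by
    rw [← lintegral_const_mul' _ _ ENNReal.ofReal_ne_top]
    refine le_trans (lintegral_mono_ae ?_) (lintegral_mono_set inter_subset_left)
    filter_upwards [ae_restrict_mem ((measurableSet_carrier Ω).inter measurableSet_ball)] with y hy
    refine enorm_sub_rpow_le_diffQuot hs hp u ?_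
    have := hy.2
    rw [Metric.mem_ball, dist_comm] at this
    linarith [dist_triangle x (π x) y, hπr x hx]
  refine (mul_le_mul' (ENNReal.inv_le_inv.2 (hdens _ (hπ x) r hr hrρ)) h1).trans (le_of_eq ?_)
  rw [← mul_assoc, ← ENNReal.ofReal_inv_of_pos (by positivity),
    ← ENNReal.ofReal_mul (by positivity)]
  congr 2
  rw [Real.mul_rpow (by norm_num) hr.le, Real.rpow_add hr, Real.rpow_natCast]
  field_simp

/-- The difference of the averages over nearby balls, at a point. -/
theorem enorm_average_sub_average_le (hs : 0 < s) (hp : 1 < p) (hc : 0 < c)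
    (hdens : ∀ x ∈ Ω.carrier, ∀ r, 0 < r → r < ρ →
      ENNReal.ofReal (c * r ^ N) ≤ volume (Ω.carrier ∩ Metric.ball x r))
    {u : EuclideanSpace ℝ (Fin N) → ℝ} (hu : IntegrableOn u Ω.carrier)
    {x a b : EuclideanSpace ℝ (Fin N)} {r : ℝ} (hr : 0 < r) (hrρ : r < ρ)
    (ha : a ∈ Ω.carrier) (hb : b ∈ Ω.carrier) (hax : dist x a < r / 2) (hbx : dist x b < r) :
    ‖(⨍ y in Ω.carrier ∩ Metric.ball a (r / 2), u y) -
        ⨍ z in Ω.carrier ∩ Metric.ball b r, u z‖ₑ ^ p ≤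
      ENNReal.ofReal (2 ^ N * c⁻¹ ^ 2 * 3 ^ ((N : ℝ) + p * s) * r ^ (p * s - N)) *
        ∫⁻ y in Ω.carrier, (Metric.ball x r).indicator
          (fun y => ∫⁻ z in Ω.carrier, ‖diffQuot s p u (y, z)‖ₑ ^ p) y := by
  have hr2 : 0 < r / 2 := by linarith
  refine (enorm_average_sub_average_rpow_le (volume_inter_ball_ne_zero ha hr2)
    (volume_inter_ball_ne_top _ _) (volume_inter_ball_ne_zero hb hr)
    (volume_inter_ball_ne_top _ _) hp (hu.mono_set inter_subset_left)
    (hu.mono_set inter_subset_left)).trans ?_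
  have h1 : ∫⁻ y in Ω.carrier ∩ Metric.ball a (r / 2), ∫⁻ z in Ω.carrier ∩ Metric.ball b r,
        ‖u y - u z‖ₑ ^ p ≤
      ENNReal.ofReal ((3 * r) ^ ((N : ℝ) + p * s)) *
        ∫⁻ y in Ω.carrier, (Metric.ball x r).indicator
          (fun y => ∫⁻ z in Ω.carrier, ‖diffQuot s p u (y, z)‖ₑ ^ p) y := by
    rw [← lintegral_const_mul' _ _ ENNReal.ofReal_ne_top]
    refine le_trans (lintegral_mono_ae ?_) (lintegral_mono_set inter_subset_left)
    filter_upwards [ae_restrict_mem ((measurableSet_carrier Ω).inter measurableSet_ball)] with y hy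
    have hy2 := Metric.mem_ball.1 hy.2
    have hyx : dist y x < r := by
      rw [dist_comm] at hax
      linarith [dist_triangle y a x]
    rw [indicator_of_mem (Metric.mem_ball.2 hyx), ← lintegral_const_mul' _ _ ENNReal.ofReal_ne_top]
    refine le_trans (lintegral_mono_ae ?_) (lintegral_mono_set inter_subset_left)
    filter_upwards [ae_restrict_mem ((measurableSet_carrier Ω).inter measurableSet_ball)] with z hz
    refine enorm_sub_rpow_le_diffQuot hs hp u ?_
    have hz2 := Metric.mem_ball'.1 hz.2
    linarith [dist_triangle y x z, dist_triangle x b z]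
  refine (mul_le_mul' (ENNReal.inv_le_inv.2 (hdens a ha _ hr2 (by linarith))) (mul_le_mul'
    (ENNReal.inv_le_inv.2 (hdens b hb r hr hrρ)) h1)).trans (le_of_eq ?_)
  rw [← mul_assoc, ← mul_assoc, ← ENNReal.ofReal_inv_of_pos (by positivity),
    ← ENNReal.ofReal_inv_of_pos (by positivity), ← ENNReal.ofReal_mul (by positivity),
    ← ENNReal.ofReal_mul (by positivity)]
  congr 2
  rw [Real.mul_rpow (by norm_num) hr.le, Real.rpow_add hr, Real.rpow_sub hr, Real.rpow_natCast,
    div_pow]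
  field_simp

/-- Tonelli's theorem for integrals over balls with variable centre. -/
theorem lintegral_indicator_ball_le {V : EuclideanSpace ℝ (Fin N) → ℝ≥0∞} (hV : Measurable V)
    (S : Set (EuclideanSpace ℝ (Fin N))) {r : ℝ} (hr : 0 < r) :
    ∫⁻ x in S, ∫⁻ y in S, (Metric.ball x r).indicator V y ≤
      (ENNReal.ofReal (r ^ N) * volume (Metric.ball (0 : EuclideanSpace ℝ (Fin N)) 1)) *
        ∫⁻ y in S, V y := by
  have hset : MeasurableSet {z : EuclideanSpace ℝ (Fin N) × EuclideanSpace ℝ (Fin N) |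
      dist z.2 z.1 < r} := measurableSet_lt (measurable_snd.dist measurable_fst) measurable_const
  have hm : Measurable fun z : EuclideanSpace ℝ (Fin N) × EuclideanSpace ℝ (Fin N) =>
      (Metric.ball z.1 r).indicator V z.2 :=
    (hV.comp measurable_snd).indicator hset
  rw [lintegral_lintegral_swap hm.aemeasurable, ← lintegral_const_mul _ hV]
  refine lintegral_mono fun y => ?_
  have e : ∀ x, (Metric.ball x r).indicator V y = (Metric.ball y r).indicator (fun _ => V y) x := by
    intro x
    by_cases h : dist y x < r
    · rw [indicator_of_mem (Metric.mem_ball.2 h), indicator_of_mem (Metric.mem_ball'.2 h)]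
    · rw [indicator_of_notMem (fun h' => h (Metric.mem_ball.1 h')),
        indicator_of_notMem (fun h' => h (Metric.mem_ball'.1 h'))]
  simp only [e]
  rw [lintegral_indicator_const measurableSet_ball, mul_comm]
  refine mul_le_mul_left ((Measure.restrict_apply_le _ _).trans (le_of_eq ?_)) _
  rw [Measure.addHaar_ball_of_pos _ _ hr, finrank_euclideanSpace, Fintype.card_fin]

/-- If `v^p ≤ h` with `h` bounded, then the `L^q` norm of `v` is controlled by interpolating
between the supremum and the integral of `h`. -/
theorem lintegral_rpow_le_of_bound {α : Type*} [MeasurableSpace α] {μ : Measure α} {p q : ℝ}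
    (hp : 1 < p) (hpq : p < q) {v h : α → ℝ≥0∞} {M m : ℝ≥0∞} (hvh : ∀ᵐ x ∂μ, v x ^ p ≤ h x)
    (hM : ∀ x, h x ≤ M) (hm : ∫⁻ x, h x ∂μ ≤ m * M) (hMt : M ≠ ∞) :
    ∫⁻ x, v x ^ q ∂μ ≤ m * M ^ (q / p) := by
  have hqp : 0 < q / p - 1 := by rw [sub_pos, one_lt_div (by linarith)]; exact hpq
  calc ∫⁻ x, v x ^ q ∂μ ≤ ∫⁻ x, M ^ (q / p - 1) * h x ∂μ := by
        refine lintegral_mono_ae ?_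
        filter_upwards [hvh] with x hx
        calc v x ^ q = (v x ^ p) ^ (q / p) := by
              rw [← ENNReal.rpow_mul, mul_div_cancel₀ _ (by linarith : p ≠ 0)]
          _ ≤ h x ^ (q / p) := ENNReal.rpow_le_rpow hx (by linarith)
          _ = h x ^ (q / p - 1) * h x := by
              conv_rhs => rw [← ENNReal.rpow_one (h x), ← ENNReal.rpow_mul, one_mul,
                ← ENNReal.rpow_add_of_nonneg _ _ hqp.le zero_le_one]
              rw [sub_add_cancel]
          _ ≤ _ := mul_le_mul_left (ENNReal.rpow_le_rpow (hM x) hqp.le) _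
    _ = M ^ (q / p - 1) * ∫⁻ x, h x ∂μ :=
        lintegral_const_mul' _ _ (ENNReal.rpow_ne_top_of_nonneg hqp.le hMt)
    _ ≤ M ^ (q / p - 1) * (m * M) := mul_le_mul_right hm _
    _ = m * (M ^ (q / p - 1) * M ^ (1 : ℝ)) := by rw [ENNReal.rpow_one]; ring
    _ = m * M ^ (q / p) := by
        rw [← ENNReal.rpow_add_of_nonneg _ _ hqp.le zero_le_one, sub_add_cancel]

end Averages

/-! ### The compact embedding into `L^q(Ω)` -/

section Embedding

variable {N : ℕ} {Ω : BoundedLipschitzDomain N} {s p : ℝ}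

instance isFiniteMeasure_restrict_carrier (Ω : BoundedLipschitzDomain N) :
    IsFiniteMeasure (volume.restrict Ω.carrier) :=
  ⟨by simpa using Ω.isBounded.measure_lt_top⟩

theorem innerEnergy_le {u : EuclideanSpace ℝ (Fin N) → ℝ} (hu : Measurable u) :
    innerEnergy Ω s p u ≤ ∫⁻ z in crossSet Ω, ‖diffQuot s p u z‖ₑ ^ p := by
  have hm : Measurable fun z => ‖diffQuot s p u z‖ₑ ^ p :=
    (measurable_diffQuot hu).enorm.pow_const _
  rw [innerEnergy, ← lintegral_prod (μ := volume.restrict Ω.carrier)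
    (ν := volume.restrict Ω.carrier) (fun z => ‖diffQuot s p u z‖ₑ ^ p) hm.aemeasurable,
    Measure.prod_restrict]
  refine lintegral_mono_set fun z hz => ?_
  simp [crossSet, hz.1]

theorem XSpace.measurable [Fact (1 < p)] (u : XSpace Ω s p) : Measurable u :=
  u.1.measurable

theorem innerEnergy_le_norm [hp : Fact (1 < p)] (u : XSpace Ω s p) :
    innerEnergy Ω s p u ≤ ENNReal.ofReal (‖u‖ ^ p) := by
  have h1 := hp.out
  refine (innerEnergy_le u.measurable).trans ?_
  have h2 : ∫⁻ z in crossSet Ω, ‖diffQuot s p u z‖ₑ ^ p =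
      ENNReal.ofReal (‖diffQuotL Ω s p u‖ ^ p) := by
    rw [← gagliardoEnergy_eq, gagliardoEnergy, ofReal_integral_eq_lintegral_ofReal u.2.1
      (Eventually.of_forall fun z => gagliardoIntegrand_nonneg s p u z)]
    refine lintegral_congr fun z => ?_
    rw [← norm_diffQuot_rpow s h1, ← ofReal_norm,
      ENNReal.ofReal_rpow_of_nonneg (norm_nonneg _) (by linarith)]
  rw [h2, norm_rpow_eq]
  exact ENNReal.ofReal_le_ofReal (le_add_of_nonneg_right (by positivity))

theorem XSpace.integrableOn [hp : Fact (1 < p)] (u : XSpace Ω s p) :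
    IntegrableOn u Ω.carrier :=
  u.memLp.2.integrable (by simpa using hp.out.le)

/-- The average over a piece of `Ω`, as a bounded linear functional on `X`. -/
theorem exists_averageL [hp : Fact (1 < p)] (x : EuclideanSpace ℝ (Fin N)) (r : ℝ) :
    ∃ l : XSpace Ω s p →L[ℝ] ℝ, ∀ u, l u = ⨍ y in Ω.carrier ∩ Metric.ball x r, u y := by
  have hm : MeasurableSet (Ω.carrier ∩ Metric.ball x r) :=
    (measurableSet_carrier Ω).inter measurableSet_ball
  let φ : Lp ℝ (ENNReal.ofReal p.conjExponent) (volume.restrict Ω.carrier) :=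
    indicatorConstLp _ hm (measure_ne_top _ _) (volume.real (Ω.carrier ∩ Metric.ball x r))⁻¹
  refine ⟨((ContinuousLinearMap.mul ℝ ℝ).lpPairing _ (ENNReal.ofReal p.conjExponent)
    (ENNReal.ofReal p) φ).comp (restrictL Ω s p), fun u => ?_⟩
  rw [ContinuousLinearMap.comp_apply, ContinuousLinearMap.lpPairing_eq_integral, setAverage_eq,
    smul_eq_mul, ← integral_const_mul]
  have : ∫ y in Ω.carrier ∩ Metric.ball x r, (volume.real (Ω.carrier ∩ Metric.ball x r))⁻¹ * u y =
      ∫ y in Ω.carrier, (Ω.carrier ∩ Metric.ball x r).indicator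
        (fun y => (volume.real (Ω.carrier ∩ Metric.ball x r))⁻¹ * u y) y := by
    rw [integral_indicator hm, Measure.restrict_restrict hm,
      inter_eq_left.2 inter_subset_left]
  rw [this]
  refine integral_congr_ae ?_
  filter_upwards [coeFn_restrictL u, indicatorConstLp_coeFn (p := ENNReal.ofReal p.conjExponent)
    (hs := hm) (hμs := measure_ne_top (volume.restrict Ω.carrier) _)
    (c := (volume.real (Ω.carrier ∩ Metric.ball x r))⁻¹)] with y hy hy'
  rw [hy, hy', ContinuousLinearMap.mul_apply']
  by_cases h : y ∈ Ω.carrier ∩ Metric.ball x r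
  · rw [indicator_of_mem h, indicator_of_mem h]
  · rw [indicator_of_notMem h, indicator_of_notMem h, zero_mul]

/-- Replacing `u` by its averages around the points of a finite net is an operator of finite rank
from `X` to `L^q(Ω)`. -/
theorem exists_averageOperator [hp : Fact (1 < p)] (q : ℝ) [hq : Fact (1 < q)]
    (π : SimpleFunc (EuclideanSpace ℝ (Fin N)) (EuclideanSpace ℝ (Fin N))) (r : ℝ) :
    ∃ T : XSpace Ω s p →L[ℝ] Lp ℝ (ENNReal.ofReal q) (volume.restrict Ω.carrier),
      IsCompactOperator T ∧ ∀ u, T u =ᵐ[volume.restrict Ω.carrier]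
        fun x => ⨍ y in Ω.carrier ∩ Metric.ball (π x) r, u y := by
  choose l hl using fun x => exists_averageL (Ω := Ω) (s := s) (p := p) x r
  let e : EuclideanSpace ℝ (Fin N) → Lp ℝ (ENNReal.ofReal q) (volume.restrict Ω.carrier) := fun c =>
    indicatorConstLp _ (π.measurableSet_fiber c) (measure_ne_top _ _) 1
  refine ⟨∑ c ∈ π.range, (l c).smulRight (e c), ?_, fun u => ?_⟩
  · have h : ∀ t : Finset (EuclideanSpace ℝ (Fin N)),
        IsCompactOperator (∑ c ∈ t, (l c).smulRight (e c) : XSpace Ω s p →L[ℝ]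
          Lp ℝ (ENNReal.ofReal q) (volume.restrict Ω.carrier)) := by
      intro t
      induction t using Finset.cons_induction with
      | empty => simpa using isCompactOperator_zero
      | cons c t hc ih =>
        rw [Finset.sum_cons]
        have h1 : IsCompactOperator (ContinuousLinearMap.toSpanSingleton ℝ (e c)) :=
          isCompactOperator_of_locallyCompactSpace_rng
            (ContinuousLinearMap.toSpanSingleton ℝ (e c))
        exact (h1.comp_clm (l c)).add ih
    exact h _
  · have h1 : (∑ c ∈ π.range, (l c).smulRight (e c)) u = ∑ c ∈ π.range, l c u • e c := by
      simp
    rw [h1]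
    refine (Lp.coeFn_finsetSum _ _).trans ?_
    have h2 : ∀ᵐ x ∂volume.restrict Ω.carrier, ∀ c ∈ π.range,
        (l c u • e c : Lp ℝ (ENNReal.ofReal q) (volume.restrict Ω.carrier)) x =
          (π ⁻¹' {c}).indicator (fun _ => l c u) x := by
      rw [eventually_all_finset]
      intro c _
      filter_upwards [Lp.coeFn_smul (l c u) (e c), indicatorConstLp_coeFn
        (p := ENNReal.ofReal q) (hs := π.measurableSet_fiber c)
        (hμs := measure_ne_top (volume.restrict Ω.carrier) _) (c := (1 : ℝ))] with x hx hx'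
      rw [hx, Pi.smul_apply, hx']
      by_cases h : x ∈ π ⁻¹' {c}
      · rw [indicator_of_mem h, indicator_of_mem h, smul_eq_mul, mul_one]
      · rw [indicator_of_notMem h, indicator_of_notMem h, smul_zero]
    filter_upwards [h2] with x hx
    rw [Finset.sum_apply, Finset.sum_congr rfl hx,
      Finset.sum_eq_single_of_mem (π x) (π.mem_range_self x), indicator_of_mem (by simp), hl]
    intro c _ hc
    exact indicator_of_notMem (fun h => hc (by simpa using h.symm)) _

/-- The power of the radius left after interpolating, with `ω r^N` the volume of a ball. -/
theorem scaling_identity {q r U ω B : ℝ} (hp : 1 < p) (hq : 1 < q) (hr : 0 < r) (hU : 0 ≤ U)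
    (hω : 0 ≤ ω) (hB : 0 ≤ B) :
    (r ^ N * ω * (B * r ^ (p * s - N) * U ^ p) ^ (q / p)) ^ (1 / q) =
      ω ^ (1 / q) * B ^ (1 / p) * r ^ ((N : ℝ) / q + (p * s - N) / p) * U := by
  have hp0 : 0 < p := by linarith
  have hq0 : 0 < q := by linarith
  rw [Real.mul_rpow (by positivity) (by positivity), Real.mul_rpow (by positivity) hω,
    ← Real.rpow_mul (by positivity), show q / p * (1 / q) = 1 / p by field_simp,
    Real.mul_rpow (by positivity) (by positivity), Real.mul_rpow hB (by positivity),
    ← Real.rpow_mul hU, mul_one_div_cancel hp0.ne', Real.rpow_one, ← Real.rpow_natCast,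
    ← Real.rpow_mul hr.le, ← Real.rpow_mul hr.le, mul_one_div, mul_one_div, Real.rpow_add hr]
  ring

/-- The difference of the averages at two successive scales, in `L^q(Ω)`. -/
theorem exists_eLpNorm_average_sub_average_le [hp : Fact (1 < p)] {q : ℝ} (hs : 0 < s)
    (hpq : p < q) {c ρ : ℝ} (hc : 0 < c) (hdens : ∀ x ∈ Ω.carrier, ∀ r, 0 < r → r < ρ →
      ENNReal.ofReal (c * r ^ N) ≤ volume (Ω.carrier ∩ Metric.ball x r)) :
    ∃ C : ℝ, 0 ≤ C ∧ ∀ (u : XSpace Ω s p) (r : ℝ), 0 < r → r < ρ →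
      ∀ π π' : EuclideanSpace ℝ (Fin N) → EuclideanSpace ℝ (Fin N),
      (∀ x, π x ∈ Ω.carrier) → (∀ x ∈ Ω.carrier, dist x (π x) < r) →
      (∀ x, π' x ∈ Ω.carrier) → (∀ x ∈ Ω.carrier, dist x (π' x) < r / 2) →
      eLpNorm (fun x => (⨍ y in Ω.carrier ∩ Metric.ball (π' x) (r / 2), u y) -
          ⨍ y in Ω.carrier ∩ Metric.ball (π x) r, u y) (ENNReal.ofReal q)
        (volume.restrict Ω.carrier) ≤
      ENNReal.ofReal (C * r ^ ((N : ℝ) / q + (p * s - N) / p) * ‖u‖) := by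
  have h1 := hp.out
  have hq : 1 < q := h1.trans hpq
  set ω := volume (Metric.ball (0 : EuclideanSpace ℝ (Fin N)) 1) with hω
  have hωt : ω ≠ ∞ := measure_ball_lt_top.ne
  set B : ℝ := 2 ^ N * c⁻¹ ^ 2 * 3 ^ ((N : ℝ) + p * s) with hB
  have hB0 : 0 ≤ B := by positivity
  refine ⟨ω.toReal ^ (1 / q) * B ^ (1 / p), by positivity, ?_⟩
  intro u r hr hrρ π π' hπ hπr hπ' hπr'
  set V : EuclideanSpace ℝ (Fin N) → ℝ≥0∞ := fun y =>
    ∫⁻ z in Ω.carrier, ‖diffQuot s p u (y, z)‖ₑ ^ p with hV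
  have hVm : Measurable V :=
    ((measurable_diffQuot (s := s) (p := p) u.measurable).enorm.pow_const p).lintegral_prod_right'
  set M : ℝ≥0∞ := ENNReal.ofReal (B * r ^ (p * s - N) * ‖u‖ ^ p) with hM
  have hVM : ENNReal.ofReal (B * r ^ (p * s - N)) * ∫⁻ y in Ω.carrier, V y ≤ M := by
    rw [hM, ENNReal.ofReal_mul (p := B * r ^ (p * s - N)) (by positivity)]
    exact mul_le_mul_right (innerEnergy_le_norm u) _
  have key := lintegral_rpow_le_of_bound (μ := volume.restrict Ω.carrier) (p := p) (q := q)
    (v := fun x => ‖(⨍ y in Ω.carrier ∩ Metric.ball (π' x) (r / 2), u y) -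
          ⨍ y in Ω.carrier ∩ Metric.ball (π x) r, u y‖ₑ)
    (h := fun x => ENNReal.ofReal (B * r ^ (p * s - N)) *
      ∫⁻ y in Ω.carrier, (Metric.ball x r).indicator V y) (M := M)
    (m := ENNReal.ofReal (r ^ N) * ω) h1 hpq ?_ ?_ ?_ ENNReal.ofReal_ne_top
  · rw [eLpNorm_eq_lintegral_rpow_enorm_toReal (ofReal_ne_zero_of_one_lt hq) ENNReal.ofReal_ne_top,
      toReal_ofReal_of_one_lt hq]
    refine (ENNReal.rpow_le_rpow key (by positivity)).trans (le_of_eq ?_)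
    rw [hM, ENNReal.ofReal_rpow_of_nonneg (by positivity) (by positivity),
      ← ENNReal.ofReal_toReal hωt, ← ENNReal.ofReal_mul (by positivity),
      ← ENNReal.ofReal_mul (by positivity),
      ENNReal.ofReal_rpow_of_nonneg (by positivity) (by positivity),
      scaling_identity h1 hq hr (norm_nonneg _) ENNReal.toReal_nonneg hB0,
      ENNReal.toReal_ofReal ENNReal.toReal_nonneg]
  · filter_upwards [ae_restrict_mem (measurableSet_carrier Ω)] with x hx
    exact enorm_average_sub_average_le hs h1 hc hdens u.integrableOn hr hrρ (hπ' x) (hπ x)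
      (hπr' x hx) (hπr x hx)
  · intro x
    refine le_trans (mul_le_mul_right (lintegral_mono fun y => ?_) _) hVM
    exact indicator_le_self _ _ _
  · rw [lintegral_const_mul' _ _ ENNReal.ofReal_ne_top]
    refine (mul_le_mul_right (lintegral_indicator_ball_le hVm _ hr) _).trans ?_
    rw [mul_left_comm]
    exact mul_le_mul_right hVM _

/-- The compact Sobolev embedding `X → L^q(Ω)` for subcritical `q`: the averaging operators at the
scales `2^{-k}` have finite rank and converge geometrically in operator norm. -/
theorem exists_compact_embedding [hp : Fact (1 < p)] {q : ℝ} [hq : Fact (1 < q)] (hs : 0 < s)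
    (hpq : p < q) (hθ : 0 < (N : ℝ) / q + (p * s - N) / p) :
    ∃ T : XSpace Ω s p →L[ℝ] Lp ℝ (ENNReal.ofReal q) (volume.restrict Ω.carrier),
      IsCompactOperator T ∧ ∀ u, T u =ᵐ[volume.restrict Ω.carrier] u := by
  have h1 := hp.out
  have hps : 0 < p * s := by positivity
  obtain ⟨c, hc, ρ, hρ, hdens⟩ := exists_measure_density Ω
  obtain ⟨C, hC, hstep⟩ := exists_eLpNorm_average_sub_average_le (s := s) (p := p) hs hpq hc hdens
  set θ : ℝ := (N : ℝ) / q + (p * s - N) / p with hθdef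
  set r : ℕ → ℝ := fun k => ρ / 2 * (1 / 2) ^ k with hr
  have hr0 : ∀ k, 0 < r k := fun k => by positivity
  have hrρ : ∀ k, r k < ρ := fun k => by
    have : ((1 : ℝ) / 2) ^ k ≤ 1 := pow_le_one₀ (by norm_num) (by norm_num)
    simp only [hr]
    nlinarith
  have hrs : ∀ k, r (k + 1) = r k / 2 := fun k => by simp only [hr, pow_succ]; ring
  have hrt : Tendsto r atTop (𝓝 0) := by
    simpa [hr] using (tendsto_pow_atTop_nhds_zero_of_lt_one (r := (1 / 2 : ℝ)) (by norm_num)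
      (by norm_num)).const_mul (ρ / 2)
  choose π hπ hπr using fun k => exists_simpleFunc_dist_lt Ω (hr0 k)
  choose T hTc hT using fun k => exists_averageOperator (Ω := Ω) (s := s) (p := p) q (π k) (r k)
  have hTstep : ∀ k, dist (T k) (T (k + 1)) ≤ C * (ρ / 2) ^ θ * ((1 / 2) ^ θ) ^ k := by
    intro k
    rw [dist_comm, dist_eq_norm]
    refine ContinuousLinearMap.opNorm_le_bound _ (by positivity) fun u => ?_
    have h2 := hstep u (r k) (hr0 k) (hrρ k) (π k) (π (k + 1)) (hπ k) (hπr k) (hπ (k + 1))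
      (by rw [← hrs]; exact hπr (k + 1))
    rw [sub_apply, Lp.norm_def]
    refine ENNReal.toReal_le_of_le_ofReal (by positivity) ?_
    have h3 : (T (k + 1) u - T k u : Lp ℝ (ENNReal.ofReal q) (volume.restrict Ω.carrier)) =ᵐ[
        volume.restrict Ω.carrier] fun x =>
          (⨍ y in Ω.carrier ∩ Metric.ball (π (k + 1) x) (r k / 2), u y) -
            ⨍ y in Ω.carrier ∩ Metric.ball (π k x) (r k), u y := by
      filter_upwards [Lp.coeFn_sub (T (k + 1) u) (T k u), hT (k + 1) u, hT k u] with x hx hx1 hx2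
      rw [hx, Pi.sub_apply, hx1, hx2, hrs]
    rw [eLpNorm_congr_ae h3]
    refine h2.trans (le_of_eq ?_)
    congr 2
    rw [mul_assoc]
    congr 1
    simp only [hr]
    rw [Real.mul_rpow (by positivity) (by positivity), ← Real.rpow_natCast, ← Real.rpow_natCast,
      ← Real.rpow_mul (by norm_num), ← Real.rpow_mul (by norm_num), mul_comm θ]
  have hcauchy : CauchySeq T := cauchySeq_of_le_geometric ((1 / 2 : ℝ) ^ θ) (C * (ρ / 2) ^ θ)
    (Real.rpow_lt_one (by norm_num) (by norm_num) hθ) hTstep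
  obtain ⟨T', hT'⟩ := cauchySeq_tendsto_of_complete hcauchy
  refine ⟨T', isCompactOperator_of_tendsto hT' (Eventually.of_forall hTc), fun u => ?_⟩
  have hlim : Tendsto (fun k => T k u) atTop (𝓝 (T' u)) :=
    ((ContinuousLinearMap.apply ℝ _ u).continuous.tendsto T').comp hT'
  have hmeas := tendstoInMeasure_of_tendsto_Lp hlim
  have hmeas' : TendstoInMeasure (volume.restrict Ω.carrier) (fun k => T k u) atTop u := by
    refine tendstoInMeasure_of_tendsto_eLpNorm (ofReal_ne_zero_of_one_lt h1)
      (fun k => (Lp.memLp (T k u)).1) u.memLp.2.1 ?_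
    have hE : innerEnergy Ω s p u ≠ ∞ :=
      ((innerEnergy_le_norm u).trans_lt ENNReal.ofReal_lt_top).ne
    have hbound : ∀ k, eLpNorm ((T k u : EuclideanSpace ℝ (Fin N) → ℝ) -
        (u : EuclideanSpace ℝ (Fin N) → ℝ)) (ENNReal.ofReal p)
        (volume.restrict Ω.carrier) ≤ (ENNReal.ofReal (c⁻¹ * 2 ^ ((N : ℝ) + p * s) *
          r k ^ (p * s)) * innerEnergy Ω s p u) ^ (1 / p) := by
      intro k
      rw [eLpNorm_sub_comm, eLpNorm_eq_lintegral_rpow_enorm_toReal (ofReal_ne_zero_of_one_lt h1)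
        ENNReal.ofReal_ne_top, toReal_ofReal_of_one_lt h1]
      refine ENNReal.rpow_le_rpow (le_trans (le_of_eq ?_) (lintegral_enorm_sub_average_le hs h1 hc
        hdens u.integrableOn (hr0 k) (hrρ k) (hπ k) (hπr k))) (by positivity)
      refine lintegral_congr_ae ?_
      filter_upwards [hT k u] with x hx
      rw [Pi.sub_apply, hx]
    refine tendsto_of_tendsto_of_tendsto_of_le_of_le tendsto_const_nhds ?_ (fun k => zero_le)
      hbound
    have h2 : Tendsto (fun k => c⁻¹ * 2 ^ ((N : ℝ) + p * s) * r k ^ (p * s)) atTop (𝓝 0) := by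
      have := (hrt.rpow_const (p := p * s) (Or.inr hps.le)).const_mul
        (c⁻¹ * 2 ^ ((N : ℝ) + p * s))
      rwa [Real.zero_rpow hps.ne', mul_zero] at this
    have h3 := ENNReal.Tendsto.mul_const (ENNReal.tendsto_ofReal h2)
      (b := innerEnergy Ω s p u) (Or.inr hE)
    rw [ENNReal.ofReal_zero, zero_mul] at h3
    have h4 := h3.ennrpow_const (1 / p)
    rwa [ENNReal.zero_rpow_of_pos (by positivity)] at h4
  exact tendstoInMeasure_ae_unique hmeas hmeas'

end Embedding

/-! ### Strong monotonicity of the derivative of `‖·‖^p` -/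

section Monotone

theorem tendsto_fst_atTop_prod : Tendsto (fun n : ℕ × ℕ => n.1) atTop atTop := by
  rw [← prod_atTop_atTop_eq]; exact tendsto_fst

theorem tendsto_snd_atTop_prod : Tendsto (fun n : ℕ × ℕ => n.2) atTop atTop := by
  rw [← prod_atTop_atTop_eq]; exact tendsto_snd

theorem tendsto_sub_atTop_prod {E : Type*} [NormedAddCommGroup E] {f : ℕ → E} {a : E}
    (hf : Tendsto f atTop (𝓝 a)) :
    Tendsto (fun n : ℕ × ℕ => f n.1 - f n.2) atTop (𝓝 0) := by
  simpa using (hf.comp tendsto_fst_atTop_prod).sub (hf.comp tendsto_snd_atTop_prod)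

variable {α : Type*} [MeasurableSpace α] {μ : Measure α} {p : ℝ} [hp : Fact (1 < p)]

/-- The integrated form of `exists_abs_sub_rpow_le`. -/
theorem exists_norm_sub_rpow_le {ε : ℝ} (hε : 0 < ε)
    (hΦ : PowerGrowth μ p fun _ => absRpowDeriv p) :
    ∃ C : ℝ, 0 ≤ C ∧ ∀ f h : Lp ℝ (ENNReal.ofReal p) μ, ‖f - h‖ ^ p ≤
      C * (hΦ.deriv f - hΦ.deriv h) (f - h) + ε * (‖f‖ ^ p + ‖h‖ ^ p) := by
  have h1 := hp.out
  obtain ⟨C, hC, hineq⟩ := exists_abs_sub_rpow_le h1 hε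
  refine ⟨C, hC, fun f h => ?_⟩
  have hfm := Lp.memLp f
  have hhm := Lp.memLp h
  have i1 : Integrable (fun x => absRpowDeriv p (f x) * (f - h) x) μ :=
    integrable_mul_of_memLp_conj (hΦ.memLp hfm) (Lp.memLp (f - h))
  have i2 : Integrable (fun x => absRpowDeriv p (h x) * (f - h) x) μ :=
    integrable_mul_of_memLp_conj (hΦ.memLp hhm) (Lp.memLp (f - h))
  have i3 := integrable_abs_rpow h1 hfm
  have i4 := integrable_abs_rpow h1 hhm
  have i5 : Integrable (fun x => C * (absRpowDeriv p (f x) * (f - h) x -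
      absRpowDeriv p (h x) * (f - h) x)) μ := (i1.sub i2).const_mul C
  have i6 : Integrable (fun x => ε * (|f x| ^ p + |h x| ^ p)) μ := (i3.add i4).const_mul ε
  rw [sub_apply, hΦ.deriv_apply, hΦ.deriv_apply, ← integral_sub i1 i2, norm_Lp_rpow, norm_Lp_rpow,
    norm_Lp_rpow, ← integral_add i3 i4, ← integral_const_mul, ← integral_const_mul,
    ← integral_add i5 i6]
  refine integral_mono_ae (integrable_abs_rpow h1 (Lp.memLp _)) (i5.add i6) ?_
  filter_upwards [Lp.coeFn_sub f h] with x hx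
  simp only [hx, Pi.sub_apply]
  refine (hineq (f x) (h x)).trans (le_of_eq ?_)
  ring

/-- Write `Ψ'` for the derivative of `‖·‖^p` on `L^p`. A bounded sequence with
`⟨Ψ'(f_n) - Ψ'(f_m), f_n - f_m⟩ → 0` is a Cauchy sequence. -/
theorem tendsto_norm_sub_of_deriv (hΦ : PowerGrowth μ p fun _ => absRpowDeriv p)
    {f : ℕ → Lp ℝ (ENNReal.ofReal p) μ} {M : ℝ} (hM : ∀ᶠ n in atTop, ‖f n‖ ≤ M)
    (hP : Tendsto (fun n : ℕ × ℕ => (hΦ.deriv (f n.1) - hΦ.deriv (f n.2)) (f n.1 - f n.2)) atTop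
      (𝓝 0)) :
    Tendsto (fun n : ℕ × ℕ => ‖f n.1 - f n.2‖) atTop (𝓝 0) := by
  have h1 := hp.out
  have hp0 : 0 < p := by linarith
  have hM0 : 0 ≤ M := by
    obtain ⟨n, hn⟩ := hM.exists
    exact (norm_nonneg _).trans hn
  have hMM : ∀ᶠ n : ℕ × ℕ in atTop, ‖f n.1‖ ≤ M ∧ ‖f n.2‖ ≤ M :=
    (tendsto_fst_atTop_prod.eventually hM).and (tendsto_snd_atTop_prod.eventually hM)
  have hDp : Tendsto (fun n : ℕ × ℕ => ‖f n.1 - f n.2‖ ^ p) atTop (𝓝 0) := by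
    rw [tendsto_order]
    refine ⟨fun a ha => Eventually.of_forall fun n => ha.trans_le (by positivity), fun η hη => ?_⟩
    obtain ⟨C, hC, hineq⟩ := exists_norm_sub_rpow_le (ε := η / (4 * (M ^ p + 1)))
      (by positivity) hΦ
    have h2 := hP.const_mul C
    rw [mul_zero] at h2
    filter_upwards [hMM, h2.eventually_lt_const (half_pos hη)] with n hn hlt
    refine (hineq (f n.1) (f n.2)).trans_lt ?_
    have h3 : ‖f n.1‖ ^ p ≤ M ^ p := Real.rpow_le_rpow (norm_nonneg _) hn.1 hp0.le
    have h4 : ‖f n.2‖ ^ p ≤ M ^ p := Real.rpow_le_rpow (norm_nonneg _) hn.2 hp0.le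
    have h5 : η / (4 * (M ^ p + 1)) * (‖f n.1‖ ^ p + ‖f n.2‖ ^ p) ≤ η / 2 := by
      have hMp : 0 ≤ M ^ p := by positivity
      rw [div_mul_eq_mul_div, div_le_iff₀ (by positivity)]
      nlinarith
    linarith
  have h2 := hDp.rpow_const (p := 1 / p) (Or.inr (by positivity))
  rw [Real.zero_rpow (by positivity)] at h2
  refine h2.congr fun n => ?_
  rw [← Real.rpow_mul (norm_nonneg _), mul_one_div_cancel hp0.ne', Real.rpow_one]

theorem deriv_absRpowDeriv_self (hΦ : PowerGrowth μ p fun _ => absRpowDeriv p)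
    (f : Lp ℝ (ENNReal.ofReal p) μ) : hΦ.deriv f f = p * ‖f‖ ^ p := by
  rw [hΦ.deriv_apply, norm_Lp_rpow, ← integral_const_mul]
  simp only [absRpowDeriv_mul_self hp.out]

end Monotone

theorem exists_mul_rpow_le {a b K k : ℝ} (ha : 0 ≤ a) (hab : a < b) (hK : 0 ≤ K) (hk : 0 < k) :
    ∃ C : ℝ, ∀ x : ℝ, 0 ≤ x → K * x ^ a ≤ k * x ^ b + C := by
  set y : ℝ := (K / k) ^ (1 / (b - a)) with hy
  have hy0 : 0 ≤ y := by positivity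
  refine ⟨K * y ^ a, fun x hx => ?_⟩
  have hxb : 0 ≤ k * x ^ b := by positivity
  rcases le_total x y with h | h
  · have := mul_le_mul_of_nonneg_left (Real.rpow_le_rpow hx h ha) hK
    linarith
  · have h1 : K / k ≤ x ^ (b - a) := by
      have := Real.rpow_le_rpow hy0 h (by linarith : 0 ≤ b - a)
      rwa [hy, ← Real.rpow_mul (by positivity), one_div_mul_cancel (by linarith),
        Real.rpow_one] at this
    have h2 : x ^ b = x ^ (b - a) * x ^ a := by
      rw [← Real.rpow_add_of_nonneg hx (by linarith) ha, sub_add_cancel]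
    rw [div_le_iff₀ hk] at h1
    have h3 := mul_le_mul_of_nonneg_right h1 (Real.rpow_nonneg hx a)
    have h4 : 0 ≤ K * y ^ a := by positivity
    rw [h2]
    nlinarith

/-! ### Derivative and Palais–Smale sequences of the functional -/

section PalaisSmale

variable {N : ℕ} {Ω : BoundedLipschitzDomain N} {s p q : ℝ} [hp : Fact (1 < p)]
  [hq : Fact (1 < q)] {f : EuclideanSpace ℝ (Fin N) → ℝ → ℝ}
  {T : XSpace Ω s p →L[ℝ] Lp ℝ (ENNReal.ofReal q) (volume.restrict Ω.carrier)}

/-- The functional `[u]^p / 2p - ∫_Ω F(x,u) dx`, with `F(x,t) = ∫₀ᵗ f(x,τ) dτ`, where the embedding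
`T` of `X` into `L^q(Ω)` is made explicit. -/
noncomputable def modelFunctional (f : EuclideanSpace ℝ (Fin N) → ℝ → ℝ)
    (T : XSpace Ω s p →L[ℝ] Lp ℝ (ENNReal.ofReal q) (volume.restrict Ω.carrier))
    (u : XSpace Ω s p) : ℝ :=
  1 / (2 * p) * ‖diffQuotL Ω s p u‖ ^ p - integralFunctional (volume.restrict Ω.carrier) f (T u)

/-- The derivative of `modelFunctional`. -/
noncomputable def modelDeriv (hf : PowerGrowth (volume.restrict Ω.carrier) q f)
    (T : XSpace Ω s p →L[ℝ] Lp ℝ (ENNReal.ofReal q) (volume.restrict Ω.carrier))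
    (u : XSpace Ω s p) : XSpace Ω s p →L[ℝ] ℝ :=
  (1 / (2 * p)) • ((powerGrowth_absRpowDeriv _ hp.out).deriv (diffQuotL Ω s p u)).comp
    (diffQuotL Ω s p) - (hf.deriv (T u)).comp T

theorem hasFDerivAt_modelFunctional (hf : PowerGrowth (volume.restrict Ω.carrier) q f)
    (u : XSpace Ω s p) : HasFDerivAt (modelFunctional f T) (modelDeriv hf T u) u := by
  have h1 := ((powerGrowth_absRpowDeriv (volume.restrict (crossSet Ω)) hp.out).hasFDerivAt
    (diffQuotL Ω s p u)).comp u (diffQuotL Ω s p).hasFDerivAt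
  have h2 := (hf.hasFDerivAt (T u)).comp u T.hasFDerivAt
  refine ((h1.const_mul (1 / (2 * p))).sub h2).congr_of_eventuallyEq
    (Eventually.of_forall fun v => ?_)
  simp [modelFunctional, integralFunctional_absRpowDeriv]

theorem continuous_modelDeriv (hf : PowerGrowth (volume.restrict Ω.carrier) q f) :
    Continuous (modelDeriv hf T) := by
  have h1 : Continuous fun u : XSpace Ω s p =>
      ((powerGrowth_absRpowDeriv (volume.restrict (crossSet Ω)) hp.out).deriv
        (diffQuotL Ω s p u)).comp (diffQuotL Ω s p) :=
    ((powerGrowth_absRpowDeriv _ hp.out).continuous_deriv.comp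
      (diffQuotL Ω s p).continuous).clm_comp continuous_const
  have h2 : Continuous fun u : XSpace Ω s p => (hf.deriv (T u)).comp T :=
    (hf.continuous_deriv.comp T.continuous).clm_comp continuous_const
  exact (h1.const_smul (1 / (2 * p))).sub h2

theorem contDiff_modelFunctional (hf : PowerGrowth (volume.restrict Ω.carrier) q f) :
    ContDiff ℝ 1 (modelFunctional f T) :=
  contDiff_one_iff_hasFDerivAt.2
    ⟨modelDeriv hf T, continuous_modelDeriv hf, hasFDerivAt_modelFunctional hf⟩

/-- Under an Ambrosetti–Rabinowitz condition, the functional and its derivative control the norm. -/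
theorem exists_norm_rpow_le (hf : PowerGrowth (volume.restrict Ω.carrier) q f)
    (hT : ∀ u, T u =ᵐ[volume.restrict Ω.carrier] u) {σ : ℝ} (hσ : p < σ)
    {b : EuclideanSpace ℝ (Fin N) → ℝ} (hb : IntegrableOn b Ω.carrier)
    (hAR : ∀ᵐ x ∂volume.restrict Ω.carrier, ∀ t : ℝ,
      |t| ^ p - b x ≤ σ⁻¹ * (f x t * t) - ∫ τ in (0 : ℝ)..t, f x τ) :
    ∃ κ > 0, ∃ B : ℝ, ∀ u : XSpace Ω s p,
      κ * ‖u‖ ^ p ≤ B + modelFunctional f T u - σ⁻¹ * modelDeriv hf T u u := by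
  have h1 := hp.out
  have hp0 : 0 < p := by linarith
  have hσ0 : 0 < σ := by linarith
  set κ : ℝ := 1 / (2 * p) - σ⁻¹ * (1 / 2) with hκ
  have hκ0 : 0 < κ := by
    rw [hκ, sub_pos, ← one_div, one_div_mul_one_div, one_div_lt_one_div (by positivity)
      (by positivity)]
    linarith
  have hκ1 : κ ≤ 1 := by
    have : 1 / (2 * p) ≤ 1 := by rw [div_le_one (by positivity)]; linarith
    have : 0 ≤ σ⁻¹ * (1 / 2) := by positivity
    linarith
  refine ⟨κ, hκ0, ∫ x in Ω.carrier, b x, fun u => ?_⟩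
  have hTm := Lp.memLp (T u)
  have i1 : Integrable (fun x => |u x| ^ p) (volume.restrict Ω.carrier) := u.2.2
  have i2 : Integrable (fun x => f x (T u x) * T u x) (volume.restrict Ω.carrier) :=
    integrable_mul_of_memLp_conj (hf.memLp hTm) hTm
  have i3 := hf.integrable_primitive hTm
  have hint : ‖restrictL Ω s p u‖ ^ p - ∫ x in Ω.carrier, b x ≤
      σ⁻¹ * hf.deriv (T u) (T u) - integralFunctional (volume.restrict Ω.carrier) f (T u) := by
    rw [← powIntegral_eq, powIntegral, ← integral_sub i1 hb, hf.deriv_apply, integralFunctional,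
      ← integral_const_mul, ← integral_sub (i2.const_mul _) i3]
    refine integral_mono_ae (i1.sub hb) ((i2.const_mul _).sub i3) ?_
    filter_upwards [hAR, hT u] with x hx hTx
    simp only [hTx]
    exact hx (u x)
  have hderiv : modelDeriv hf T u u = 1 / 2 * ‖diffQuotL Ω s p u‖ ^ p - hf.deriv (T u) (T u) := by
    have : modelDeriv hf T u u = 1 / (2 * p) * (powerGrowth_absRpowDeriv
      (volume.restrict (crossSet Ω)) h1).deriv (diffQuotL Ω s p u) (diffQuotL Ω s p u) -
        hf.deriv (T u) (T u) := rfl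
    rw [this, deriv_absRpowDeriv_self]
    field_simp
  have hR0 : 0 ≤ ‖restrictL Ω s p u‖ ^ p := by positivity
  have hR1 : κ * ‖restrictL Ω s p u‖ ^ p ≤ ‖restrictL Ω s p u‖ ^ p :=
    mul_le_of_le_one_left hR0 hκ1
  rw [hderiv, modelFunctional, norm_rpow_eq, mul_add]
  have : κ * ‖diffQuotL Ω s p u‖ ^ p = 1 / (2 * p) * ‖diffQuotL Ω s p u‖ ^ p -
      σ⁻¹ * (1 / 2 * ‖diffQuotL Ω s p u‖ ^ p) := by rw [hκ]; ring
  linarith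

/-- As `Ω` has finite measure, the `L^q` norm controls the `L^p` norm. -/
theorem exists_norm_restrictL_le (hpq : p < q)
    (hT : ∀ u, T u =ᵐ[volume.restrict Ω.carrier] u) :
    ∃ C : ℝ, ∀ u, ‖restrictL Ω s p u‖ ≤ C * ‖T u‖ := by
  have h := fun u : XSpace Ω s p =>
    eLpNorm_le_eLpNorm_mul_rpow_measure_univ (μ := volume.restrict Ω.carrier)
      (ENNReal.ofReal_le_ofReal hpq.le) (Lp.memLp (T u)).1
  refine ⟨((volume.restrict Ω.carrier) univ ^
    (1 / (ENNReal.ofReal p).toReal - 1 / (ENNReal.ofReal q).toReal)).toReal, fun u => ?_⟩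
  have hexp : 0 ≤ 1 / (ENNReal.ofReal p).toReal - 1 / (ENNReal.ofReal q).toReal := by
    rw [toReal_ofReal_of_one_lt hp.out, toReal_ofReal_of_one_lt hq.out, sub_nonneg]
    exact one_div_le_one_div_of_le (by linarith [hp.out]) hpq.le
  have hae : restrictL Ω s p u =ᵐ[volume.restrict Ω.carrier] T u :=
    (coeFn_restrictL u).trans (hT u).symm
  rw [Lp.norm_def, Lp.norm_def, mul_comm, ← ENNReal.toReal_mul, eLpNorm_congr_ae hae]
  exact ENNReal.toReal_mono (ENNReal.mul_ne_top (Lp.eLpNorm_ne_top _)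
    (ENNReal.rpow_ne_top_of_nonneg hexp (measure_ne_top _ _))) (h u)

/-- The monotone part of the derivative, in terms of the whole derivative and the part of lower
order. -/
theorem deriv_diffQuotL_sub_apply (hf : PowerGrowth (volume.restrict Ω.carrier) q f)
    (u v : XSpace Ω s p) :
    ((powerGrowth_absRpowDeriv (volume.restrict (crossSet Ω)) hp.out).deriv (diffQuotL Ω s p u) -
      (powerGrowth_absRpowDeriv (volume.restrict (crossSet Ω)) hp.out).deriv
        (diffQuotL Ω s p v)) (diffQuotL Ω s p u - diffQuotL Ω s p v) =
    2 * p * ((modelDeriv hf T u - modelDeriv hf T v) (u - v) +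
      (hf.deriv (T u) - hf.deriv (T v)) (T u - T v)) := by
  have h1 := hp.out
  have e : ∀ a b : XSpace Ω s p, modelDeriv hf T a b =
      1 / (2 * p) * (powerGrowth_absRpowDeriv (volume.restrict (crossSet Ω)) hp.out).deriv
        (diffQuotL Ω s p a) (diffQuotL Ω s p b) - hf.deriv (T a) (T b) := fun a b => rfl
  rw [← map_sub, ← map_sub, sub_apply, sub_apply, sub_apply, e, e]
  field_simp
  ring

/-- A bounded sequence with `I'(u_n) → 0` whose image in `L^q(Ω)` converges is a Cauchy sequence:
testing `I'(u_n) - I'(u_m)` with `u_n - u_m` controls the monotone part of the derivative. -/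
theorem cauchySeq_of_modelDeriv (hf : PowerGrowth (volume.restrict Ω.carrier) q f) (hpq : p < q)
    (hT : ∀ u, T u =ᵐ[volume.restrict Ω.carrier] u) {v : ℕ → XSpace Ω s p} {M : ℝ}
    (hM : ∀ᶠ n in atTop, ‖v n‖ ≤ M)
    (hder : Tendsto (fun n => modelDeriv hf T (v n)) atTop (𝓝 0))
    {w : Lp ℝ (ENNReal.ofReal q) (volume.restrict Ω.carrier)}
    (hw : Tendsto (fun n => T (v n)) atTop (𝓝 w)) : CauchySeq v := by
  have h1 := hp.out
  have hp0 : 0 < p := by linarith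
  have hTT := tendsto_sub_atTop_prod hw
  have hJ := tendsto_sub_atTop_prod ((hf.continuous_deriv.tendsto w).comp hw)
  have hI := tendsto_sub_atTop_prod hder
  obtain ⟨CR, hCR⟩ := exists_norm_restrictL_le (s := s) hpq hT
  have hR : Tendsto (fun n : ℕ × ℕ => ‖restrictL Ω s p (v n.1 - v n.2)‖) atTop (𝓝 0) := by
    have h2 := hTT.norm.const_mul CR
    rw [norm_zero, mul_zero] at h2
    refine squeeze_zero (fun _ => norm_nonneg _) (fun n => ?_) h2
    rw [← map_sub]
    exact hCR _
  have hMM : ∀ᶠ n : ℕ × ℕ in atTop, ‖v n.1‖ ≤ M ∧ ‖v n.2‖ ≤ M :=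
    (tendsto_fst_atTop_prod.eventually hM).and (tendsto_snd_atTop_prod.eventually hM)
  have hD : Tendsto (fun n : ℕ × ℕ => ‖diffQuotL Ω s p (v n.1) - diffQuotL Ω s p (v n.2)‖) atTop
      (𝓝 0) := by
    refine tendsto_norm_sub_of_deriv (powerGrowth_absRpowDeriv _ h1) (M := M)
      (f := fun n => diffQuotL Ω s p (v n)) ?_ ?_
    · filter_upwards [hM] with n hn
      refine le_trans ?_ hn
      refine (Real.rpow_le_rpow_iff (norm_nonneg _) (norm_nonneg _) hp0).1 ?_
      rw [norm_rpow_eq (v n)]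
      exact le_add_of_nonneg_right (by positivity)
    · have hb : Tendsto (fun n : ℕ × ℕ => 2 * p *
          (‖modelDeriv hf T (v n.1) - modelDeriv hf T (v n.2)‖ * (2 * M) +
            ‖hf.deriv (T (v n.1)) - hf.deriv (T (v n.2))‖ * ‖T (v n.1) - T (v n.2)‖)) atTop
          (𝓝 0) := by
        simpa using ((hI.norm.mul_const (2 * M)).add (hJ.norm.mul hTT.norm)).const_mul (2 * p)
      refine squeeze_zero_norm' ?_ hb
      filter_upwards [hMM] with n hn
      rw [deriv_diffQuotL_sub_apply hf (T := T), norm_mul, Real.norm_eq_abs,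
        abs_of_pos (by positivity)]
      refine mul_le_mul_of_nonneg_left ((norm_add_le _ _).trans (add_le_add ?_ ?_)) (by positivity)
      · refine (ContinuousLinearMap.le_opNorm _ _).trans
          (mul_le_mul_of_nonneg_left ?_ (norm_nonneg _))
        exact (norm_sub_le _ _).trans (by linarith [hn.1, hn.2])
      · exact ContinuousLinearMap.le_opNorm _ _
  have hsum := hD.add hR
  rw [add_zero] at hsum
  rw [cauchySeq_iff_tendsto_dist_atTop_0]
  refine squeeze_zero (fun _ => dist_nonneg) (fun n => ?_) hsum
  rw [dist_eq_norm, ← map_sub]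
  exact norm_le_add _

theorem palaisSmaleAt_modelFunctional (hf : PowerGrowth (volume.restrict Ω.carrier) q f)
    (hpq : p < q) (hTc : IsCompactOperator T)
    (hT : ∀ u, T u =ᵐ[volume.restrict Ω.carrier] u) {σ : ℝ} (hσ : p < σ)
    {b : EuclideanSpace ℝ (Fin N) → ℝ} (hb : IntegrableOn b Ω.carrier)
    (hAR : ∀ᵐ x ∂volume.restrict Ω.carrier, ∀ t : ℝ,
      |t| ^ p - b x ≤ σ⁻¹ * (f x t * t) - ∫ τ in (0 : ℝ)..t, f x τ) (c : ℝ) :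
    PalaisSmaleAt (modelFunctional f T) c := by
  intro u hu hu'
  have h1 := hp.out
  have hfd : ∀ v, fderiv ℝ (modelFunctional f T) v = modelDeriv hf T v := fun v =>
    (hasFDerivAt_modelFunctional hf v).fderiv
  simp only [hfd] at hu'
  obtain ⟨κ, hκ, B, hbound⟩ := exists_norm_rpow_le (s := s) hf hT hσ hb hAR
  obtain ⟨C, hC⟩ := exists_mul_rpow_le (K := 2) zero_le_one h1 zero_le_two hκ
  have hσ0 : 0 < σ := by linarith
  set M : ℝ := B + (c + 1) + C with hM
  have hbdd : ∀ᶠ n in atTop, ‖u n‖ ≤ M := by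
    have e1 : ∀ᶠ n in atTop, modelFunctional f T (u n) < c + 1 :=
      hu.eventually_lt_const (by linarith)
    have e2 : ∀ᶠ n in atTop, ‖modelDeriv hf T (u n)‖ < 1 := by
      have := hu'.norm
      rw [norm_zero] at this
      exact this.eventually_lt_const one_pos
    filter_upwards [e1, e2] with n hn1 hn2
    have h2 := hbound (u n)
    have h3 := hC ‖u n‖ (norm_nonneg _)
    rw [Real.rpow_one] at h3
    have h4 : -(σ⁻¹ * modelDeriv hf T (u n) (u n)) ≤ ‖u n‖ := by
      refine (neg_le_abs _).trans ?_
      rw [abs_mul, abs_of_pos (by positivity : 0 < σ⁻¹)]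
      have h5 := (modelDeriv hf T (u n)).le_opNorm (u n)
      rw [Real.norm_eq_abs] at h5
      have h6 : |modelDeriv hf T (u n) (u n)| ≤ ‖u n‖ :=
        h5.trans (mul_le_of_le_one_left (norm_nonneg _) hn2.le)
      have h7 : σ⁻¹ ≤ 1 := inv_le_one_of_one_le₀ (by linarith)
      exact (mul_le_of_le_one_left (abs_nonneg _) h7).trans h6
    linarith
  have hcpt := IsCompactOperator.isCompact_closure_image_closedBall
    (f := T.toLinearMap) hTc M
  have hmem : ∀ᶠ n in atTop, T (u n) ∈ closure (T.toLinearMap '' Metric.closedBall 0 M) :=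
    hbdd.mono fun n hn => subset_closure ⟨u n, by simpa using hn, rfl⟩
  obtain ⟨w, -, φ, hφ, hw⟩ := hcpt.tendsto_subseq' hmem.frequently
  have hcau : CauchySeq (fun n => u (φ n)) := cauchySeq_of_modelDeriv hf hpq hT
    (hφ.tendsto_atTop.eventually hbdd) (hu'.comp hφ.tendsto_atTop) hw
  obtain ⟨v, hv⟩ := cauchySeq_tendsto_of_complete hcau
  exact ⟨v, φ, hφ, hv⟩

end PalaisSmale

/-! ### The structure conditions on `g` -/

section Nonlinearity

variable {N : ℕ} {Ω : BoundedLipschitzDomain N} {s p q lam : ℝ}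
  {g : EuclideanSpace ℝ (Fin N) → ℝ → ℝ}

theorem PowerGrowth.add {α : Type*} [MeasurableSpace α] {μ : Measure α} {f h : α → ℝ → ℝ}
    (hf : PowerGrowth μ q f) (hh : PowerGrowth μ q h) :
    PowerGrowth μ q fun x t => f x t + h x t where
  aemeasurable t := (hf.aemeasurable t).add (hh.aemeasurable t)
  continuous := by
    filter_upwards [hf.continuous, hh.continuous] with x h1 h2
    exact h1.add h2
  bound := by
    obtain ⟨a, b, hb, ha, h1⟩ := hf.bound
    obtain ⟨a', b', hb', ha', h2⟩ := hh.bound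
    refine ⟨fun x => a x + a' x, b + b', by positivity, ha.add ha', ?_⟩
    filter_upwards [h1, h2] with x h1 h2 t
    refine (abs_add_le _ _).trans ?_
    linarith [h1 t, h2 t]

theorem PowerGrowth.of_condG1 (hg : IsCaratheodory Ω g) {a₁ a₂ : ℝ} (ha₂ : 0 < a₂)
    (hbd : ∀ᵐ x ∂volume.restrict Ω.carrier, ∀ t : ℝ, |g x t| ≤ a₁ + a₂ * |t| ^ (q - 1)) :
    PowerGrowth (volume.restrict Ω.carrier) q g :=
  ⟨hg.1, hg.2, fun _ => a₁, a₂, ha₂.le, memLp_const _, hbd⟩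

theorem rpow_sub_one_le_one_add (hp : 1 < p) (hpq : p < q) {t : ℝ} (ht : 0 ≤ t) :
    t ^ (p - 1) ≤ 1 + t ^ (q - 1) := by
  rcases le_total t 1 with h | h
  · have := Real.rpow_le_one ht h (by linarith : 0 ≤ p - 1)
    linarith [Real.rpow_nonneg ht (q - 1)]
  · have := Real.rpow_le_rpow_of_exponent_le h (by linarith : p - 1 ≤ q - 1)
    linarith

theorem powerGrowth_const_mul_absRpowDeriv (hp : 1 < p) (hpq : p < q) (k : ℝ) :
    PowerGrowth (volume.restrict Ω.carrier) q fun _ t => k * absRpowDeriv p t where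
  aemeasurable _ := aemeasurable_const
  continuous := Eventually.of_forall fun _ => continuous_const.mul (continuous_absRpowDeriv hp)
  bound := by
    have hp0 : 0 < p := by linarith
    refine ⟨fun _ => |k| * p, |k| * p, by positivity, memLp_const _,
      Eventually.of_forall fun _ t => ?_⟩
    rw [abs_mul, abs_absRpowDeriv hp]
    have := mul_le_mul_of_nonneg_left (rpow_sub_one_le_one_add hp hpq (abs_nonneg t))
      (by positivity : 0 ≤ |k| * p)
    linarith

theorem primitive_add_absRpowDeriv (hp : 1 < p) {x : EuclideanSpace ℝ (Fin N)}
    (hx : Continuous (g x)) (k t : ℝ) :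
    ∫ τ in (0 : ℝ)..t, (g x τ + k * absRpowDeriv p τ) = primitive g x t + k * |t| ^ p := by
  have h : Continuous fun τ => k * absRpowDeriv p τ :=
    continuous_const.mul (continuous_absRpowDeriv hp)
  rw [intervalIntegral.integral_add (hx.intervalIntegrable _ _) (h.intervalIntegrable _ _),
    intervalIntegral.integral_const_mul, integral_absRpowDeriv hp, primitive]

/-- The `λ`-term is absorbed into the nonlinearity. -/
theorem energyFunctional_eq [hp : Fact (1 < p)] [hq : Fact (1 < q)]
    (hg : PowerGrowth (volume.restrict Ω.carrier) q g)
    {T : XSpace Ω s p →L[ℝ] Lp ℝ (ENNReal.ofReal q) (volume.restrict Ω.carrier)}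
    (hT : ∀ u, T u =ᵐ[volume.restrict Ω.carrier] u) :
    energyFunctional Ω s p lam g =
      modelFunctional (fun x t => g x t + lam / p * absRpowDeriv p t) T := by
  funext u
  have h1 : integralFunctional (volume.restrict Ω.carrier)
      (fun x t => g x t + lam / p * absRpowDeriv p t) (T u) =
      ∫ x in Ω.carrier, (primitive g x (u x) + lam / p * |u x| ^ p) := by
    refine integral_congr_ae ?_
    filter_upwards [hg.continuous, hT u] with x hx hTx
    rw [hTx, primitive_add_absRpowDeriv hp.out hx]
  have h2 : IntegrableOn (fun x => primitive g x (u x)) Ω.carrier := by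
    refine (hg.integrable_primitive (Lp.memLp (T u))).congr ?_
    filter_upwards [hT u] with x hTx
    rw [hTx, primitive]
  rw [modelFunctional, h1, integral_add h2 (u.2.2.const_mul _), integral_const_mul,
    energyFunctional, gagliardoEnergy_eq, powIntegral]
  ring

/-- The Ambrosetti–Rabinowitz inequality for `g + λ |t|^{p-2} t`, with any exponent `σ` strictly
between `p` and the one of `g`: the superlinear lower bound on `G` absorbs the `λ`-term. -/
theorem exists_ambrosetti_rabinowitz (hp : 1 < p) (hlam : 0 ≤ lam) {R a₁ a₂ μ μ' a₃ : ℝ}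
    (hR : 0 ≤ R) (ha₁ : 0 < a₁) (ha₂ : 0 < a₂) (hq : 1 < q) (hc : ∀ᵐ x ∂volume.restrict Ω.carrier,
      Continuous (g x))
    (hbd : ∀ᵐ x ∂volume.restrict Ω.carrier, ∀ t : ℝ, |g x t| ≤ a₁ + a₂ * |t| ^ (q - 1))
    (hμ : p < μ) (hAR : ∀ᵐ x ∂volume.restrict Ω.carrier, ∀ t : ℝ, R < |t| →
      0 < μ * primitive g x t ∧ μ * primitive g x t ≤ g x t * t)
    (hμ' : p < μ') (ha₃ : 0 < a₃) {a₄ : EuclideanSpace ℝ (Fin N) → ℝ}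
    (ha₄ : IntegrableOn a₄ Ω.carrier)
    (hlow : ∀ᵐ x ∂volume.restrict Ω.carrier, ∀ t : ℝ, a₃ * |t| ^ μ' - a₄ x ≤ primitive g x t) :
    ∃ σ : ℝ, p < σ ∧ ∃ b : EuclideanSpace ℝ (Fin N) → ℝ, IntegrableOn b Ω.carrier ∧
      ∀ᵐ x ∂volume.restrict Ω.carrier, ∀ t : ℝ, |t| ^ p - b x ≤
        σ⁻¹ * ((g x t + lam / p * absRpowDeriv p t) * t) -
          ∫ τ in (0 : ℝ)..t, (g x τ + lam / p * absRpowDeriv p τ) := by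
  have hp0 : 0 < p := by linarith
  set σ : ℝ := (p + μ) / 2 with hσ
  have hσp : p < σ := by linarith
  have hσ0 : 0 < σ := by linarith
  have hμ0 : 0 < μ := by linarith
  set δ : ℝ := σ⁻¹ * μ - 1 with hδ
  have hδ0 : 0 < δ := by
    rw [hδ, sub_pos, ← div_eq_inv_mul, one_lt_div hσ0]
    linarith
  set m : ℝ := (a₁ + a₂ * R ^ (q - 1)) * R with hm
  have hm0 : 0 ≤ m := by positivity
  obtain ⟨C, hC⟩ := exists_mul_rpow_le hp0.le hμ' (K := 1 + lam / p) (by positivity)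
    (mul_pos hδ0 ha₃)
  refine ⟨σ, hσp, fun x => δ * a₄ x + (σ⁻¹ * (m + μ * m) + C),
    (ha₄.const_mul δ).add (integrable_const _), ?_⟩
  filter_upwards [hc, hbd, hAR, hlow] with x hx hxb hxAR hxl t
  rw [primitive_add_absRpowDeriv hp hx]
  have h1 : δ * primitive g x t - σ⁻¹ * (m + μ * m) ≤ σ⁻¹ * (g x t * t) - primitive g x t := by
    -- the growth bound takes over where `|t| ≤ R`
    have hkey : -(m + μ * m) ≤ g x t * t - μ * primitive g x t := by
      rcases lt_or_ge R |t| with h | h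
      · have := (hxAR t h).2
        have : 0 ≤ μ * m := by positivity
        linarith
      · have hle : (a₁ + a₂ * |t| ^ (q - 1)) * |t| ≤ m := by
          rw [hm]
          gcongr
        have h2 : |g x t * t| ≤ m := by
          rw [abs_mul]
          exact (mul_le_mul_of_nonneg_right (hxb t) (abs_nonneg t)).trans hle
        have h3 : |primitive g x t| ≤ m := (abs_primitive_le_of_bound ha₂.le hq hxb t).trans hle
        have h4 := mul_le_mul_of_nonneg_left (le_of_abs_le h3) hμ0.le
        linarith [neg_le_of_abs_le h2]
    have h5 := mul_le_mul_of_nonneg_left hkey (inv_pos.2 hσ0).le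
    rw [hδ]
    linarith
  have h2 := mul_le_mul_of_nonneg_left (hxl t) hδ0.le
  have h3 := hC |t| (abs_nonneg t)
  have h4 : 0 ≤ σ⁻¹ * (lam / p * (absRpowDeriv p t * t)) := by
    rw [absRpowDeriv_mul_self hp]
    positivity
  linarith

/-- For subcritical `q`, the difference of the averages at scales `r` and `r / 2` decays in `r`. -/
theorem subcritical_exponent_pos (hN : 1 ≤ N) (hp : 1 < p) (hpq : p < q)
    (hsub : p * s < N → q < p * N / (N - p * s)) :
    0 < (N : ℝ) / q + (p * s - N) / p := by
  have hp0 : 0 < p := by linarith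
  have hq0 : 0 < q := by linarith
  have hN0 : (0 : ℝ) < N := by exact_mod_cast hN
  rw [div_add_div _ _ hq0.ne' hp0.ne']
  refine div_pos ?_ (by positivity)
  rcases lt_or_ge (p * s) N with h | h
  · have := hsub h
    rw [lt_div_iff₀ (by linarith)] at this
    linarith
  · have h1 : 0 ≤ q * (p * s - N) := mul_nonneg hq0.le (by linarith)
    have h2 : 0 < (N : ℝ) * p := by positivity
    linarith

end Nonlinearity

end FracNeumann

theorem proposition3p3 {N : ℕ} (hN : 1 ≤ N) (Ω : BoundedLipschitzDomain N)
    (s p lam : ℝ) (hs₀ : 0 < s) (hs₁ : s < 1) [hp : Fact (1 < p)] (hlam : 0 ≤ lam)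
    (g : EuclideanSpace ℝ (Fin N) → ℝ → ℝ) (hg : FracNeumann.IsCaratheodory Ω g)
    (R : ℝ) (hR : 0 ≤ R)
    (hg₁ : FracNeumann.CondG1 Ω s p g) (hg₂ : FracNeumann.CondG2 Ω p g)
    (hg₃ : FracNeumann.CondG3 Ω p g R) (hg₄ : FracNeumann.CondG4 Ω g R) :
    (∀ u : FracNeumann.XSpace Ω s p, MeasureTheory.IntegrableOn
      (fun x => FracNeumann.primitive g x (u x)) Ω.carrier) ∧
    ContDiff ℝ 1 (FracNeumann.energyFunctional Ω s p lam g) ∧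
    ∀ c : ℝ, PalaisSmaleAt (FracNeumann.energyFunctional Ω s p lam g) c := by
  obtain ⟨a₁, a₂, q, ha₁, ha₂, hpq, hsub, hbd⟩ := hg₁
  obtain ⟨⟨μ, hμ, hAR⟩, μ', a₃, a₄, hμ', ha₃, ha₄, hlow⟩ := hg₃
  have h1 := hp.out
  have hq : Fact (1 < q) := ⟨h1.trans hpq⟩
  obtain ⟨T, hTc, hT⟩ := FracNeumann.exists_compact_embedding (Ω := Ω) (s := s) (p := p) hs₀ hpq
    (FracNeumann.subcritical_exponent_pos hN h1 hpq hsub)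
  have hgrow := FracNeumann.PowerGrowth.of_condG1 hg ha₂ hbd
  have hgrow' := hgrow.add
    (FracNeumann.powerGrowth_const_mul_absRpowDeriv (Ω := Ω) h1 hpq (lam / p))
  obtain ⟨σ, hσ, b, hb, hARσ⟩ := FracNeumann.exists_ambrosetti_rabinowitz h1 hlam hR ha₁ ha₂ hq.out
    hg.2 hbd hμ hAR hμ' ha₃ ha₄ hlow
  rw [FracNeumann.energyFunctional_eq (lam := lam) hgrow hT]
  refine ⟨fun u => ?_, FracNeumann.contDiff_modelFunctional hgrow', fun c =>
    FracNeumann.palaisSmaleAt_modelFunctional hgrow' hpq hTc hT hσ hb hARσ c⟩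
  refine (hgrow.integrable_primitive (Lp.memLp (T u))).congr ?_
  filter_upwards [hT u] with x hTx
  rw [hTx, FracNeumann.primitive]
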